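/- **Setting.** Let $k,q\ge 1$ and consider the plant $$\dot y=A_1y+\tilde g_1(y,z,u),\qquad \dot z=A_2z+B_2u+\tilde g_2(y,z,u),\qquad y\in\mathbb R^k,\ z\in\mathbb R^q,\ u\in\mathbb R^m,$$ with $\tilde g_1,\tilde g_2$ twice continuously differentiable and vanishing at the origin together with their first derivatives, and the feedback $K(y;z)=K_{11}z+K_{12}y+K_n(y)$ with $K_n$ continuously differentiable, $K_n(0)=0$ and $B_2\,DK_n(0)=0$. Assume that $A_K=A_2+B_2K_{11}$ has only eigenvalues with negative real part, let $E$ satisfy $A_KE-EA_1+B_2K_{12}=0$, and put $v=z-Ey$ and $K_1=[\,K_{12}+K_{11}E\;\;K_{11}\,]$. Let $h$ be a continuously differentiable local center manifold of the closed loop with $u=K(y;z)$, defined near $0\in\mathbb R^k$: $h(0)=0$, $Dh(0)=0$, and $v=h(y)$ is locally invariant. Put $w=v-h(y)$. Assume $A_1=0$ and that, for some $p>1$ and $k_5,k_6>0$, the function $g_1(y)=\tilde g_1(y,h(y)+Ey,K(y;h(y)+Ey))$ satisfies $\|g_1(y)\|\le k_5\|y\|^p$ and $y^\top g_1(y)\le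 -k_6\|y\|^{p+1}$ near $0$ (so $y=0$ is a locally asymptotically stable equilibrium of the reduced system $\dot y=g_1(y)$). Let $h^a$ be a polynomial map with $h(y)=h^a(y)+\mathcal O(\|y\|^s)$ for some $s>p$, and put $w^a=v-h^a(y)$. Let $P,Q\succ0$ satisfy $A_K^\top P+PA_K=-Q$, let $V(y,w)=\|y\|+\sqrt{w^\top Pw}$, $\alpha_1(r)=\min(1,\sqrt{\lambda_{\min}(P)})\,r$, $\alpha_2(r)=\sqrt2\max(1,\sqrt{\lambda_{\max}(P)})\,r$, and let $s_f\in(0,1)$ and $\sigma>0$ satisfy $$2\sigma\,\|PB_2K_1\|\sqrt{\lambda_{\max}(P)}\le(1-s_f)\,\lambda_{\min}(Q)\sqrt{\lambda_{\min}(P)} .$$ For $\delta,r_s>0$ let $\mathcal B_{r}=\{\|(y;w)\|\le r\}$, $S_v=\{\|(y;w)\|<\delta,\ V(y,w)\le\alpha_1(\delta)\}$ and $S_2=\{\|(y;w)\|<\alpha_2^{-1}(\alpha_1(r_s))\}$. **Implementation.** Let $t_1=\min\{t\ge t_0: (y(t);w(t))\in S_v\setminus S_2\}$ and, for $i\ge1$,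 $$t_{i+1}=\min\{t\ge t_i:\ \|e(t)\|\ge\sigma(\|w^a(t)\|+\|y(t)\|^{p+1})\ \text{and}\ (y(t);w(t))\in S_v\setminus S_2\},$$ where $e(t)=(y(t_i)-y(t);\,v(t_i)-v(t))$ on $[t_i,t_{i+1})$ (an event time is $\infty$ if there is no such $t$). The input is $u=0$ on $[t_0,t_1)$ and $u=K(y(t_i);z(t_i))$ on $[t_i,t_{i+1})$, $i\ge1$. **Claim.** There are $\delta_0>0$ and $c_y,c_w>0$ such that for every $\delta\in(0,\delta_0]$: 1. Whenever $\|(y;w)\|<\delta$ and $\|e\|\le\sigma(\|w^a\|+\|y\|^{p+1})$, one has $\zeta^\top(\dot y;\dot w)\le -c_y\|y\|^p-c_w\|w\|$ for all $\zeta\in\partial V(y,w)$, where $(\dot y;\dot w)$ is the closed-loop vector field with measurement error $e$. In particular $S_v$ is a sub-level set of $V$ on which this decrease holds. 2. For every $r_s>0$ with $\mathcal B_{r_s}\subset S_v$: from every initial state in $S_v$, at every initial time $t_0$, there is a trajectory of the event-triggered closed loop on $[t_0,\infty)$; and there are $T_b\ge0$ and $\tau>0$, independent of $t_0$ and of the trajectory,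 such that every trajectory with initial state in $S_v$, on any interval $[t_0,T)$ with $T\le\infty$ not extending beyond an accumulation point of events, stays in $S_v$, lies in $\mathcal B_{r_s}$ for all $t\ge t_0+T_b$ (local ultimate boundedness by $\mathcal B_{r_s}$), and satisfies $t_{i+1}-t_i\ge\tau$ for all $i\ge1$ (for all events that occur). -/

import Mathlib

open Set Filter Topology Asymptotics

noncomputable section

namespace EventCenter

/-- Real Euclidean space of dimension `n`. -/
abbrev Vec (n : ℕ) : Type := EuclideanSpace ℝ (Fin n)

/-- The action `M x` of a real matrix on a Euclidean vector. -/
def act {a b : ℕ} (M : Matrix (Fin a) (Fin b) ℝ) (x : Vec b) : Vec a :=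
  Matrix.toEuclideanLin M x

/-- The Euclidean norm of the concatenated vector `(a; b)`. -/
def pairNorm {a b : ℕ} (x : Vec a) (y : Vec b) : ℝ := √(‖x‖ ^ 2 + ‖y‖ ^ 2)

/-- The norm of a (rectangular) matrix induced by the Euclidean norms. -/
def opNorm {ι κ : Type*} [Fintype ι] [Fintype κ] [DecidableEq κ] (M : Matrix ι κ ℝ) : ℝ :=
  ‖LinearMap.toContinuousLinearMap (Matrix.toEuclideanLin M)‖

/-- Smallest eigenvalue of a symmetric matrix. -/
def lambdaMin {n : ℕ} (M : Matrix (Fin n) (Fin n) ℝ) : ℝ := sInf (spectrum ℝ M)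

/-- Largest eigenvalue of a symmetric matrix. -/
def lambdaMax {n : ℕ} (M : Matrix (Fin n) (Fin n) ℝ) : ℝ := sSup (spectrum ℝ M)

/-! ### The plant and the controller -/

/-- The plant
`y' = A₁ y + g₁(y, z, u)`, `z' = A₂ z + B₂ u + g₂(y, z, u)`
with twice continuously differentiable nonlinearities which vanish at the origin together
with all their first derivatives. -/
structure Plant (k q m : ℕ) where
  A₁ : Matrix (Fin k) (Fin k) ℝ
  A₂ : Matrix (Fin q) (Fin q) ℝ
  B₂ : Matrix (Fin q) (Fin m) ℝ
  g₁ : Vec k × Vec q × Vec m → Vec k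
  g₂ : Vec k × Vec q × Vec m → Vec q
  g₁_contDiff : ContDiff ℝ 2 g₁
  g₂_contDiff : ContDiff ℝ 2 g₂
  g₁_zero : g₁ 0 = 0
  g₂_zero : g₂ 0 = 0
  g₁_deriv : fderiv ℝ g₁ 0 = 0
  g₂_deriv : fderiv ℝ g₂ 0 = 0

/-- The feedback `K(y; z) = K₁₁ z + K₁₂ y + Kₙ(y)` with a continuously differentiable `Kₙ`
vanishing at the origin. -/
structure Feedback (k q m : ℕ) where
  K₁₁ : Matrix (Fin m) (Fin q) ℝ
  K₁₂ : Matrix (Fin m) (Fin k) ℝ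
  Kn : Vec k → Vec m
  Kn_contDiff : ContDiff ℝ 1 Kn
  Kn_zero : Kn 0 = 0

variable {k q m : ℕ}

/-- Right-hand side of the `y` equation of the plant. -/
def Plant.yField (S : Plant k q m) (y : Vec k) (z : Vec q) (u : Vec m) : Vec k :=
  act S.A₁ y + S.g₁ (y, z, u)

/-- Right-hand side of the `z` equation of the plant. -/
def Plant.zField (S : Plant k q m) (y : Vec k) (z : Vec q) (u : Vec m) : Vec q :=
  act S.A₂ z + act S.B₂ u + S.g₂ (y, z, u)

/-- The control law `u = K(y; z)`. -/
def Feedback.law (K : Feedback k q m) (y : Vec k) (z : Vec q) : Vec m :=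
  act K.K₁₁ z + act K.K₁₂ y + K.Kn y

/-- The matrix `A_K = A₂ + B₂ K₁₁`. -/
def AK (S : Plant k q m) (K : Feedback k q m) : Matrix (Fin q) (Fin q) ℝ :=
  S.A₂ + S.B₂ * K.K₁₁

/-- The matrix `K₁ = [K₁₂ + K₁₁ E, K₁₁]`, which acts on the error `(e_y; e_v)`. -/
def K1 (K : Feedback k q m) (E : Matrix (Fin q) (Fin k) ℝ) :
    Matrix (Fin m) (Fin k ⊕ Fin q) ℝ :=
  Matrix.fromCols (K.K₁₂ + K.K₁₁ * E) K.K₁₁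

/-! ### The closed loop in the coordinates `v = z - E y` and its center manifolds -/

/-- `y'` at the state `(y, v)` when the control is computed from the measurement
`(y + e_y, v + e_v)`. -/
def yRate (S : Plant k q m) (K : Feedback k q m) (E : Matrix (Fin q) (Fin k) ℝ)
    (y : Vec k) (v : Vec q) (ey : Vec k) (ev : Vec q) : Vec k :=
  S.yField y (v + act E y) (K.law (y + ey) (v + ev + act E (y + ey)))

/-- `v' = z' - E y'` at the state `(y, v)` when the control is computed from the measurement
`(y + e_y, v + e_v)`. -/
def vRate (S : Plant k q m) (K : Feedback k q m) (E : Matrix (Fin q) (Fin k) ℝ)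
    (y : Vec k) (v : Vec q) (ey : Vec k) (ev : Vec q) : Vec q :=
  S.zField y (v + act E y) (K.law (y + ey) (v + ev + act E (y + ey)))
    - act E (yRate S K E y v ey ev)

/-- `w'` for `w = v - h(y)`, at the state `(y, w)` and with measurement error `(e_y, e_v)`. -/
def wRate (S : Plant k q m) (K : Feedback k q m) (E : Matrix (Fin q) (Fin k) ℝ)
    (h : Vec k → Vec q) (y : Vec k) (w : Vec q) (ey : Vec k) (ev : Vec q) : Vec q :=
  vRate S K E y (w + h y) ey ev - fderiv ℝ h y (yRate S K E y (w + h y) ey ev)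

/-- `v = h(y)`, with `h` considered on the open ball of radius `ρ`, is a (local) center manifold
of the closed loop without measurement error: `h` is continuously differentiable,
`h(0) = 0`, `Dh(0) = 0`, and a solution which starts on the graph of `h` stays on it as long as
its `y` component is in the ball. -/
structure IsCenterManifold (S : Plant k q m) (K : Feedback k q m)
    (E : Matrix (Fin q) (Fin k) ℝ) (h : Vec k → Vec q) (ρ : ℝ) : Prop where
  radius_pos : 0 < ρ
  contDiffOn : ContDiffOn ℝ 1 h (Metric.ball 0 ρ)
  zero : h 0 = 0
  deriv_zero : fderiv ℝ h 0 = 0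
  invariant : ∀ (T : ℝ) (y : ℝ → Vec k) (v : ℝ → Vec q), 0 < T →
    (∀ t ∈ Ico 0 T, y t ∈ Metric.ball (0 : Vec k) ρ) →
    (∀ t ∈ Ico 0 T, HasDerivWithinAt y (yRate S K E (y t) (v t) 0 0) (Ico 0 T) t) →
    (∀ t ∈ Ico 0 T, HasDerivWithinAt v (vRate S K E (y t) (v t) 0 0) (Ico 0 T) t) →
    v 0 = h (y 0) →
    ∀ t ∈ Ico 0 T, v t = h (y t)

/-- The nonlinearity of the reduced system: `g₁(y, h(y) + E y, K(y; h(y) + E y))`. -/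
def reducedG₁ (S : Plant k q m) (K : Feedback k q m) (E : Matrix (Fin q) (Fin k) ℝ)
    (h : Vec k → Vec q) (y : Vec k) : Vec k :=
  S.g₁ (y, h y + act E y, K.law y (h y + act E y))

/-- The polynomial map with the given components. -/
def polyMap (H : Fin q → MvPolynomial (Fin k) ℝ) (y : Vec k) : Vec q :=
  WithLp.toLp 2 fun j => MvPolynomial.eval (fun i => y i) (H j)

/-! ### The Lyapunov function and the sets built from it -/

/-- `V(y, w) = ‖y‖ + √(wᵀ P w)`. -/
def lyap (P : Matrix (Fin q) (Fin q) ℝ) (y : Vec k) (w : Vec q) : ℝ :=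
  ‖y‖ + √(inner ℝ w (act P w))

/-- The subdifferential of the convex function `V` at `(y, w)`. -/
def lyapSubdiff (P : Matrix (Fin q) (Fin q) ℝ) (y : Vec k) (w : Vec q) :
    Set (Vec k × Vec q) :=
  {ζ | ∀ (y' : Vec k) (w' : Vec q),
    lyap P y w + inner ℝ ζ.1 (y' - y) + inner ℝ ζ.2 (w' - w) ≤ lyap P y' w'}

/-- The slope of `α₁(r) = min(1, √λ_min(P)) r`. -/
def slope₁ (P : Matrix (Fin q) (Fin q) ℝ) : ℝ := min 1 √(lambdaMin P)

/-- The slope of `α₂(r) = √2 max(1, √λ_max(P)) r`. -/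
def slope₂ (P : Matrix (Fin q) (Fin q) ℝ) : ℝ := √2 * max 1 √(lambdaMax P)

/-- The closed ball of radius `r` in the `(y; w)` space. -/
def ballYW (k q : ℕ) (r : ℝ) : Set (Vec k × Vec q) := {x | pairNorm x.1 x.2 ≤ r}

/-- `S_v = {(y; w) : ‖(y; w)‖ < δ, V(y, w) ≤ α₁(δ)}`. -/
def Sv (k : ℕ) {q : ℕ} (P : Matrix (Fin q) (Fin q) ℝ) (δ : ℝ) : Set (Vec k × Vec q) :=
  {x | pairNorm x.1 x.2 < δ ∧ lyap P x.1 x.2 ≤ slope₁ P * δ}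

/-- `S₂ = {(y; w) : ‖(y; w)‖ < α₂⁻¹(α₁(r_s))}`. -/
def S2 (k : ℕ) {q : ℕ} (P : Matrix (Fin q) (Fin q) ℝ) (rs : ℝ) : Set (Vec k × Vec q) :=
  {x | pairNorm x.1 x.2 < slope₁ P * rs / slope₂ P}

/-- On `‖(y; w)‖ < δ` the derivative of `V` along the closed loop is at most
`-(c_y ‖y‖ ^ p + c_w ‖w‖)` whenever the measurement error satisfies
`‖e‖ ≤ σ (‖wᵃ‖ + ‖y‖ ^ (p + 1))`, where `wᵃ = v - hᵃ(y)`. -/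
def DecreasesOn (S : Plant k q m) (K : Feedback k q m) (E : Matrix (Fin q) (Fin k) ℝ)
    (h ha : Vec k → Vec q) (P : Matrix (Fin q) (Fin q) ℝ) (σ p cy cw δ : ℝ) : Prop :=
  ∀ (y : Vec k) (w : Vec q) (ey : Vec k) (ev : Vec q), pairNorm y w < δ →
    pairNorm ey ev ≤ σ * (‖w + h y - ha y‖ + ‖y‖ ^ (p + 1)) →
    ∀ ζ ∈ lyapSubdiff P y w,
      inner ℝ ζ.1 (yRate S K E y (w + h y) ey ev) + inner ℝ ζ.2 (wRate S K E h y w ey ev)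
        ≤ -(cy * ‖y‖ ^ p + cw * ‖w‖)

/-! ### The event-triggered closed loop -/

/-- `a` is the first element of the set of times `D`, and `⊤` when there is none. -/
def IsFirstTime (D : Set ℝ) (a : EReal) : Prop :=
  (∃ r : ℝ, IsLeast D r ∧ a = (r : EReal)) ∨ (D = ∅ ∧ a = ⊤)

/-- The point `(y; w)` which belongs to the plant state `(y, z)`; here `w = z - E y - h(y)`. -/
def toYW (E : Matrix (Fin q) (Fin k) ℝ) (h : Vec k → Vec q) (y : Vec k) (z : Vec q) :
    Vec k × Vec q :=
  (y, z - act E y - h y)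

/-- At time `t` the signals `y`, `z` follow the plant equations with the input value `u`
(right derivatives, since the input is right-continuous and jumps at the events). -/
def FollowsAt (S : Plant k q m) (y : ℝ → Vec k) (z : ℝ → Vec q) (t : ℝ) (u : Vec m) : Prop :=
  HasDerivWithinAt y (S.yField (y t) (z t) u) (Ici t) t ∧
    HasDerivWithinAt z (S.zField (y t) (z t) u) (Ici t) t

/-- The triggering inequality at time `t` when the last event was at time `s`:
`‖e‖ ≥ σ (‖wᵃ‖ + ‖y‖ ^ (p + 1))` with `e = (y(s) - y(t); v(s) - v(t))`, `v = z - E y` and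
`wᵃ = v - hᵃ(y)`. -/
def Triggers (E : Matrix (Fin q) (Fin k) ℝ) (ha : Vec k → Vec q) (σ p : ℝ)
    (y : ℝ → Vec k) (z : ℝ → Vec q) (s t : ℝ) : Prop :=
  σ * (‖z t - act E (y t) - ha (y t)‖ + ‖y t‖ ^ (p + 1)) ≤
    pairNorm (y s - y t) ((z s - act E (y s)) - (z t - act E (y t)))

/-- `(y, z)` with event times `τ 1 ≤ τ 2 ≤ …` (`⊤` for events that do not happen, `τ 0 = t₀`)
is a trajectory on `[t₀, T)`, `T ≤ ∞`, of the event-triggered closed loop: the input is `0` before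
`τ 1` and is held at `K(y(τ i); z(τ i))` on `[τ i, τ (i + 1))`; the first event is the first time
in the set `D`, and each later one is the first time at which the triggering inequality holds
in the set `D`. The interval `[t₀, T)` may end at, but not extend beyond, an accumulation point
of events. -/
structure IsTrajectory (S : Plant k q m) (K : Feedback k q m) (E : Matrix (Fin q) (Fin k) ℝ)
    (h ha : Vec k → Vec q) (σ p : ℝ) (D : Set (Vec k × Vec q)) (t₀ : ℝ) (T : EReal)
    (y : ℝ → Vec k) (z : ℝ → Vec q) (τ : ℕ → EReal) : Prop where
  y_cont : ContinuousOn y {t : ℝ | t₀ ≤ t ∧ (t : EReal) < T}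
  z_cont : ContinuousOn z {t : ℝ | t₀ ≤ t ∧ (t : EReal) < T}
  start : τ 0 = (t₀ : EReal)
  first_event : IsFirstTime {t : ℝ | t₀ ≤ t ∧ (t : EReal) < T ∧ toYW E h (y t) (z t) ∈ D} (τ 1)
  next_event : ∀ i : ℕ, 1 ≤ i →
    IsFirstTime {t : ℝ | τ i ≤ (t : EReal) ∧ (t : EReal) < T ∧
      Triggers E ha σ p y z (τ i).toReal t ∧ toYW E h (y t) (z t) ∈ D} (τ (i + 1))
  zero_input : ∀ t : ℝ, t₀ ≤ t → (t : EReal) < T → (t : EReal) < τ 1 → FollowsAt S y z t 0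
  held_input : ∀ i : ℕ, 1 ≤ i → ∀ t : ℝ, τ i ≤ (t : EReal) → (t : EReal) < T →
    (t : EReal) < τ (i + 1) →
    FollowsAt S y z t (K.law (y (τ i).toReal) (z (τ i).toReal))
  exhausts : ∀ t : ℝ, t₀ ≤ t → (t : EReal) < T → ∃ i : ℕ, (t : EReal) < τ i

end EventCenter

end

/-!
In the coordinates `w = v - h(y)` invariance of the graph of `h` leaves
`w' = A_K w + B₂ K₁ e + o(‖w‖ + ‖e‖)` and `y' = g₁(y) + o(‖w‖ + ‖e‖)`, because all nonlinear terms
are differences of maps with vanishing derivative. Along a subgradient of `V` the leading terms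
contribute at most `-k₆ ‖y‖ ^ p` and `-λ_min(Q) / (2 √λ_max(P)) ‖w‖`. Since
`wᵃ = w + O(‖y‖ ^ s)` with `s > p`, the triggering bound gives `‖e‖ ≤ σ ‖w‖ + o(‖y‖ ^ p)`, and by
the gain condition on `σ` the decrease absorbs the contribution of `e`.

A right derivative of `V` along a trajectory is a pairing with a subgradient, so outside `S₂` the
function `V` decreases at a uniform rate: the sub-level set `S_v` cannot be left, and the level
`α₁(r_s)`, hence the ball of radius `r_s`, is reached within a fixed time. On the compact annulus
where events can occur the triggering bound has a positive minimum while the error grows at bounded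
speed, which separates the events. By the same gap, concatenating solutions of a cut-off field from
event to event yields a trajectory on the whole half-line.
-/

namespace EventCenter

/-! ### Matrices acting on Euclidean vectors -/

section Matrix

variable {a b c n : ℕ}

/-- The map `x ↦ M x` as a continuous linear map. -/
noncomputable def actL (M : Matrix (Fin a) (Fin b) ℝ) : Vec b →L[ℝ] Vec a :=
  LinearMap.toContinuousLinearMap (Matrix.toEuclideanLin M)

theorem coe_actL (M : Matrix (Fin a) (Fin b) ℝ) : ⇑(actL M) = act M := rfl

theorem act_add (M : Matrix (Fin a) (Fin b) ℝ) (x y : Vec b) :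
    act M (x + y) = act M x + act M y := map_add (actL M) x y

theorem act_sub (M : Matrix (Fin a) (Fin b) ℝ) (x y : Vec b) :
    act M (x - y) = act M x - act M y := map_sub (actL M) x y

theorem act_smul (M : Matrix (Fin a) (Fin b) ℝ) (r : ℝ) (x : Vec b) :
    act M (r • x) = r • act M x := map_smul (actL M) r x

@[simp]
theorem act_zero (M : Matrix (Fin a) (Fin b) ℝ) : act M 0 = 0 := map_zero (actL M)

theorem continuous_act (M : Matrix (Fin a) (Fin b) ℝ) : Continuous (act M) :=
  (actL M).continuous

theorem add_act (M N : Matrix (Fin a) (Fin b) ℝ) (x : Vec b) :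
    act (M + N) x = act M x + act N x := by
  simp [act]

theorem sub_act (M N : Matrix (Fin a) (Fin b) ℝ) (x : Vec b) :
    act (M - N) x = act M x - act N x := by
  simp [act]

theorem neg_act (M : Matrix (Fin a) (Fin b) ℝ) (x : Vec b) : act (-M) x = -act M x := by
  simp [act]

@[simp]
theorem zero_act (x : Vec b) : act (0 : Matrix (Fin a) (Fin b) ℝ) x = 0 := by
  simp [act]

@[simp]
theorem one_act (x : Vec n) : act (1 : Matrix (Fin n) (Fin n) ℝ) x = x := by
  ext i
  simp [act]

theorem mul_act (M : Matrix (Fin a) (Fin b) ℝ) (N : Matrix (Fin b) (Fin c) ℝ) (x : Vec c) :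
    act (M * N) x = act M (act N x) := by
  simp [act, Matrix.toLpLin_mul 2 2 2]

theorem algebraMap_act (r : ℝ) (x : Vec n) : act (algebraMap ℝ _ r) x = r • x := by
  simp [act, Algebra.algebraMap_eq_smul_one]

theorem inner_act_left (M : Matrix (Fin a) (Fin b) ℝ) (x : Vec b) (y : Vec a) :
    inner ℝ (act M x) y = inner ℝ x (act M.transpose y) := by
  rw [← Matrix.conjTranspose_eq_transpose_of_trivial, act, act,
    Matrix.toEuclideanLin_conjTranspose_eq_adjoint, LinearMap.adjoint_inner_right]

end Matrix

section QuadraticForm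

open scoped MatrixOrder

variable {n : ℕ} {M N : Matrix (Fin n) (Fin n) ℝ}

theorem inner_act_comm (hM : M.IsHermitian) (x y : Vec n) :
    inner ℝ x (act M y) = inner ℝ y (act M x) := by
  rw [real_inner_comm, inner_act_left, show M.transpose = M by simpa using hM.eq]

theorem inner_act_nonneg (hM : M.PosSemidef) (x : Vec n) : 0 ≤ inner ℝ x (act M x) :=
  (Matrix.isPositive_toEuclideanLin_iff.2 hM).inner_nonneg_right x

theorem inner_act_mono (hMN : M ≤ N) (x : Vec n) :
    inner ℝ x (act M x) ≤ inner ℝ x (act N x) := by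
  have h := inner_act_nonneg (Matrix.le_iff.1 hMN) x
  rwa [sub_act, inner_sub_right, sub_nonneg] at h

theorem inner_algebraMap_act (r : ℝ) (x : Vec n) :
    inner ℝ x (act (algebraMap ℝ _ r) x) = r * ‖x‖ ^ 2 := by
  rw [algebraMap_act, inner_smul_right, real_inner_self_eq_norm_sq]

theorem lambdaMin_mul_le (hM : M.IsHermitian) (x : Vec n) :
    lambdaMin M * ‖x‖ ^ 2 ≤ inner ℝ x (act M x) := by
  have h : algebraMap ℝ _ (lambdaMin M) ≤ M :=
    (algebraMap_le_iff_le_spectrum hM.isSelfAdjoint).2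
      fun _ hμ => csInf_le M.finite_real_spectrum.bddBelow hμ
  simpa only [inner_algebraMap_act] using inner_act_mono h x

theorem le_lambdaMax_mul (hM : M.IsHermitian) (x : Vec n) :
    inner ℝ x (act M x) ≤ lambdaMax M * ‖x‖ ^ 2 := by
  have h : M ≤ algebraMap ℝ _ (lambdaMax M) :=
    (le_algebraMap_iff_spectrum_le hM.isSelfAdjoint).2
      fun _ hμ => le_csSup M.finite_real_spectrum.bddAbove hμ
  simpa only [inner_algebraMap_act] using inner_act_mono h x

theorem pos_of_mem_spectrum (hM : M.PosDef) {μ : ℝ} (hμ : μ ∈ spectrum ℝ M) : 0 < μ := by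
  rw [hM.1.spectrum_real_eq_range_eigenvalues] at hμ
  obtain ⟨i, rfl⟩ := hμ
  exact hM.eigenvalues_pos i

theorem spectrum_nonempty (hn : 0 < n) (hM : M.IsHermitian) : (spectrum ℝ M).Nonempty :=
  ⟨_, hM.eigenvalues_mem_spectrum_real ⟨0, hn⟩⟩

theorem lambdaMin_pos (hn : 0 < n) (hM : M.PosDef) : 0 < lambdaMin M :=
  pos_of_mem_spectrum hM ((spectrum_nonempty hn hM.1).csInf_mem M.finite_real_spectrum)

theorem lambdaMax_pos (hn : 0 < n) (hM : M.PosDef) : 0 < lambdaMax M :=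
  pos_of_mem_spectrum hM ((spectrum_nonempty hn hM.1).csSup_mem M.finite_real_spectrum)

end QuadraticForm

/-! ### Weighted norms and their subgradients -/

section WeightedNorm

variable {n : ℕ} {M : Matrix (Fin n) (Fin n) ℝ}

/-- The seminorm `√(xᵀ M x)` of a positive semidefinite matrix `M`; it is the second summand of
the Lyapunov function. -/
noncomputable def wnorm (M : Matrix (Fin n) (Fin n) ℝ) (x : Vec n) : ℝ := √(inner ℝ x (act M x))

/-- `ζ` is a subgradient of `f` at `x`. -/
def IsSubgradient (f : Vec n → ℝ) (x ζ : Vec n) : Prop :=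
  ∀ x', f x + inner ℝ ζ (x' - x) ≤ f x'

theorem IsSubgradient.apply_eq_inner {f : Vec n → ℝ} {f' : StrongDual ℝ (Vec n)} {x ζ : Vec n}
    (hζ : IsSubgradient f x ζ) (hf : HasFDerivAt f f' x) (d : Vec n) : f' d = inner ℝ ζ d := by
  have hmin : IsLocalMin (fun x' => f x' - innerSL ℝ ζ x') x := .of_forall fun x' => by
    have := hζ x'
    rw [inner_sub_right] at this
    simp only [innerSL_apply_apply]
    linarith
  have h0 := hmin.hasFDerivAt_eq_zero (hf.sub (innerSL ℝ ζ).hasFDerivAt)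
  simpa [sub_eq_zero] using DFunLike.congr_fun h0 d

theorem wnorm_nonneg (x : Vec n) : 0 ≤ wnorm M x := Real.sqrt_nonneg _

@[simp]
theorem wnorm_zero : wnorm M 0 = 0 := by simp [wnorm]

theorem wnorm_one (x : Vec n) : wnorm 1 x = ‖x‖ := by simp [wnorm]

theorem wnorm_sq (hM : M.PosSemidef) (x : Vec n) : wnorm M x ^ 2 = inner ℝ x (act M x) :=
  Real.sq_sqrt (inner_act_nonneg hM x)

theorem continuous_wnorm : Continuous (wnorm M) :=
  (continuous_id.inner (continuous_act M)).sqrt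

open scoped MatrixOrder in
theorem exists_inner_act_eq (hM : M.PosSemidef) :
    ∃ B : Matrix (Fin n) (Fin n) ℝ,
      ∀ x y : Vec n, inner ℝ x (act M y) = inner ℝ (act B x) (act B y) := by
  obtain ⟨B, rfl⟩ := CStarAlgebra.nonneg_iff_eq_star_mul_self.1 hM.nonneg
  refine ⟨B, fun x y => ?_⟩
  rw [mul_act, inner_act_left, Matrix.star_eq_conjTranspose,
    Matrix.conjTranspose_eq_transpose_of_trivial]

theorem inner_act_le_wnorm_mul_wnorm (hM : M.PosSemidef) (x y : Vec n) :
    inner ℝ x (act M y) ≤ wnorm M x * wnorm M y := by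
  obtain ⟨B, hB⟩ := exists_inner_act_eq hM
  simpa only [wnorm, hB, ← norm_eq_sqrt_real_inner] using real_inner_le_norm (act B x) (act B y)

theorem wnorm_add_le (hM : M.PosSemidef) (x y : Vec n) :
    wnorm M (x + y) ≤ wnorm M x + wnorm M y := by
  obtain ⟨B, hB⟩ := exists_inner_act_eq hM
  simpa only [wnorm, hB, ← norm_eq_sqrt_real_inner, act_add B] using norm_add_le (act B x) (act B y)

theorem wnorm_smul (r : ℝ) (x : Vec n) : wnorm M (r • x) = |r| * wnorm M x := by
  rw [wnorm, act_smul, inner_smul_left, inner_smul_right, ← mul_assoc, conj_trivial,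
    Real.sqrt_mul (mul_self_nonneg r), Real.sqrt_mul_self_eq_abs, wnorm]

theorem wnorm_pos (hM : M.PosDef) {x : Vec n} (hx : x ≠ 0) : 0 < wnorm M x := by
  have hn : 0 < n := Nat.pos_of_ne_zero fun h => hx (by subst h; exact Subsingleton.elim _ _)
  have hx2 : 0 < lambdaMin M * ‖x‖ ^ 2 := mul_pos (lambdaMin_pos hn hM) (by positivity)
  exact Real.sqrt_pos.2 (hx2.trans_le (lambdaMin_mul_le hM.1 x))

theorem wnorm_le (hM : M.IsHermitian) (x : Vec n) : wnorm M x ≤ √(lambdaMax M) * ‖x‖ := by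
  rw [← Real.sqrt_sq (norm_nonneg x), ← Real.sqrt_mul' _ (sq_nonneg _)]
  exact Real.sqrt_le_sqrt (le_lambdaMax_mul hM x)

theorem le_wnorm (hM : M.IsHermitian) (x : Vec n) : √(lambdaMin M) * ‖x‖ ≤ wnorm M x := by
  rw [← Real.sqrt_sq (norm_nonneg x), ← Real.sqrt_mul' _ (sq_nonneg _)]
  exact Real.sqrt_le_sqrt (lambdaMin_mul_le hM x)

theorem sqrt_lambdaMin_mul_wnorm_le (hM : M.PosSemidef) (x : Vec n) :
    √(lambdaMin M) * wnorm M x ≤ ‖act M x‖ := by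
  rcases (wnorm_nonneg (M := M) x).eq_or_lt with h0 | hpos
  · simp [← h0]
  refine le_of_mul_le_mul_right ?_ hpos
  calc √(lambdaMin M) * wnorm M x * wnorm M x = √(lambdaMin M) * inner ℝ x (act M x) := by
        rw [mul_assoc, ← sq, wnorm_sq hM]
    _ ≤ √(lambdaMin M) * (‖x‖ * ‖act M x‖) := by gcongr; exact real_inner_le_norm _ _
    _ = √(lambdaMin M) * ‖x‖ * ‖act M x‖ := (mul_assoc _ _ _).symm
    _ ≤ wnorm M x * ‖act M x‖ := by gcongr; exact le_wnorm hM.1 x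
    _ = ‖act M x‖ * wnorm M x := mul_comm _ _

theorem IsSubgradient.inner_le_wnorm (hM : M.PosSemidef) {x ζ : Vec n}
    (hζ : IsSubgradient (wnorm M) x ζ) (d : Vec n) : inner ℝ ζ d ≤ wnorm M d := by
  have h := hζ (x + d)
  rw [add_sub_cancel_left] at h
  linarith [wnorm_add_le hM x d]

/-- The gradient of `wnorm M` at `x`, with value `0` where `wnorm M x = 0`. -/
noncomputable def wgrad (M : Matrix (Fin n) (Fin n) ℝ) (x : Vec n) : Vec n :=
  (wnorm M x)⁻¹ • act M x

theorem inner_wgrad (x d : Vec n) :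
    inner ℝ (wgrad M x) d = inner ℝ d (act M x) / wnorm M x := by
  rw [wgrad, inner_smul_left, conj_trivial, real_inner_comm, inv_mul_eq_div]

theorem hasFDerivAt_wnorm (hM : M.IsHermitian) {x : Vec n} (hx : wnorm M x ≠ 0) :
    HasFDerivAt (wnorm M) (innerSL ℝ (wgrad M x)) x := by
  have hsq : inner ℝ x (act M x) ≠ 0 := fun h => hx (by rw [wnorm, h, Real.sqrt_zero])
  refine (((hasFDerivAt_id x).inner ℝ (actL M).hasFDerivAt).sqrt hsq).congr_fderiv ?_
  ext d
  have hd : inner ℝ x (act M d) + inner ℝ d (act M x) = 2 * inner ℝ d (act M x) := by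
    rw [inner_act_comm hM x d, two_mul]
  rw [innerSL_apply_apply, inner_wgrad]
  simp only [id_eq, coe_actL, one_div, mul_inv_rev, smul_apply, ContinuousLinearMap.comp_apply,
    ContinuousLinearMap.prod_apply, ContinuousLinearMap.id_apply, fderivInnerCLM_apply, hd,
    smul_eq_mul, wnorm]
  ring

theorem inner_wgrad_self (hM : M.PosSemidef) (x : Vec n) :
    inner ℝ (wgrad M x) x = wnorm M x := by
  rw [inner_wgrad, ← wnorm_sq hM, sq, mul_self_div_self]

theorem inner_wgrad_le (hM : M.PosSemidef) (x d : Vec n) :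
    inner ℝ (wgrad M x) d ≤ wnorm M d := by
  rw [inner_wgrad]
  exact div_le_of_le_mul₀ (wnorm_nonneg x) (wnorm_nonneg d) (inner_act_le_wnorm_mul_wnorm hM d x)

theorem isSubgradient_wgrad (hM : M.PosSemidef) (x : Vec n) :
    IsSubgradient (wnorm M) x (wgrad M x) := fun x' => by
  rw [inner_sub_right, inner_wgrad_self hM, add_sub_cancel]
  exact inner_wgrad_le hM x x'

theorem isSubgradient_wgrad_zero (hM : M.PosSemidef) (d : Vec n) :
    IsSubgradient (wnorm M) 0 (wgrad M d) := fun x' => by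
  simpa using inner_wgrad_le hM d x'

theorem IsSubgradient.inner_eq (hM : M.PosDef) {x ζ : Vec n}
    (hζ : IsSubgradient (wnorm M) x ζ) (hx : x ≠ 0) (d : Vec n) :
    inner ℝ ζ d = inner ℝ d (act M x) / wnorm M x := by
  rw [← hζ.apply_eq_inner (hasFDerivAt_wnorm hM.1 (wnorm_pos hM hx).ne') d,
    innerSL_apply_apply, inner_wgrad]

theorem hasDerivWithinAt_wnorm_of_eq_zero {x : ℝ → Vec n} {x' : Vec n} {t : ℝ}
    (hx : HasDerivWithinAt x x' (Ici t) t) (h0 : x t = 0) :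
    HasDerivWithinAt (fun s => wnorm M (x s)) (wnorm M x') (Ici t) t := by
  rw [hasDerivWithinAt_iff_tendsto_slope] at hx ⊢
  refine (continuous_wnorm.continuousAt.tendsto.comp hx).congr' ?_
  filter_upwards [self_mem_nhdsWithin] with s hs
  have hst : 0 ≤ (s - t)⁻¹ := inv_nonneg.2 (sub_nonneg.2 hs.1)
  simp only [Function.comp_apply, slope, vsub_eq_sub, h0, sub_zero, wnorm_zero, smul_eq_mul,
    wnorm_smul, abs_of_nonneg hst]

theorem exists_subgradient_hasDerivWithinAt (hM : M.PosDef) {x : ℝ → Vec n} {x' : Vec n} {t : ℝ}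
    (hx : HasDerivWithinAt x x' (Ici t) t) :
    ∃ ζ, IsSubgradient (wnorm M) (x t) ζ ∧
      HasDerivWithinAt (fun s => wnorm M (x s)) (inner ℝ ζ x') (Ici t) t := by
  have hM' := hM.posSemidef
  by_cases h0 : x t = 0
  · refine ⟨wgrad M x', h0 ▸ isSubgradient_wgrad_zero hM' x', ?_⟩
    rw [inner_wgrad_self hM']
    exact hasDerivWithinAt_wnorm_of_eq_zero hx h0
  · exact ⟨wgrad M (x t), isSubgradient_wgrad hM' (x t),
      (hasFDerivAt_wnorm hM.1 (wnorm_pos hM h0).ne').comp_hasDerivWithinAt t hx⟩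

end WeightedNorm

/-! ### Autonomous differential equations -/

section ODE

variable {F G : Type*} [NormedAddCommGroup F] [NormedSpace ℝ F]
  [NormedAddCommGroup G] [NormedSpace ℝ G]

theorem hasDerivWithinAt_prod {f : ℝ → F × G} {f' : F × G} {s : Set ℝ} {t : ℝ} :
    HasDerivWithinAt f f' s t ↔ HasDerivWithinAt (fun r => (f r).1) f'.1 s t ∧
      HasDerivWithinAt (fun r => (f r).2) f'.2 s t :=
  ⟨fun h => ⟨by simpa using h.hasFDerivWithinAt.fst.hasDerivWithinAt,
    by simpa using h.hasFDerivWithinAt.snd.hasDerivWithinAt⟩, fun h => h.1.prodMk h.2⟩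

variable {f : F → F}

open scoped Manifold in
theorem isMIntegralCurveOn_iff_hasDerivWithinAt {x : ℝ → F} {s : Set ℝ} :
    IsMIntegralCurveOn (I := 𝓘(ℝ, F)) x f s ↔ ∀ t ∈ s, HasDerivWithinAt x (f (x t)) s t := by
  refine forall₂_congr fun t _ => ?_
  rw [hasDerivWithinAt_iff_hasFDerivWithinAt,
    ← ContinuousLinearMap.smulRight_one_eq_toSpanSingleton]
  exact hasMFDerivWithinAt_iff_hasFDerivWithinAt

variable [CompleteSpace F]

theorem exists_local_solution (hf : ContDiff ℝ 1 f) {x₀ : F} {U : Set F} (hU : U ∈ 𝓝 x₀) :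
    ∃ T > 0, ∃ x : ℝ → F, x 0 = x₀ ∧ ∀ t ∈ Ico 0 T, x t ∈ U ∧ HasDerivAt x (f (x t)) t := by
  obtain ⟨x, rfl, ε, hε, hx⟩ :=
    (hf.contDiffAt (x := x₀)).exists_forall_mem_closedBall_exists_eq_forall_mem_Ioo_hasDerivAt₀ 0
  rw [zero_sub, zero_add] at hx
  obtain ⟨r, hr, hrU⟩ := Metric.eventually_nhds_iff.1
    ((hx 0 ⟨neg_neg_of_pos hε, hε⟩).continuousAt.eventually_mem hU)
  refine ⟨min ε r, lt_min hε hr, x, rfl, fun t ht => ⟨hrU ?_, hx t ⟨?_, ?_⟩⟩⟩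
  · rw [Real.dist_0_eq_abs, abs_of_nonneg ht.1]
    exact ht.2.trans_le (min_le_right _ _)
  · linarith [ht.1]
  · exact ht.2.trans_le (min_le_left _ _)

open scoped Manifold in
theorem exists_global_solution (hf : ContDiff ℝ 1 f) (hs : HasCompactSupport f) (a : ℝ) (x₀ : F) :
    ∃ x : ℝ → F, x a = x₀ ∧ ∀ t, HasDerivAt x (f (x t)) t := by
  obtain ⟨L, hL⟩ := hf.lipschitzWith_of_hasCompactSupport hs one_ne_zero
  obtain ⟨C, hC⟩ := hs.exists_bound_of_continuous hf.continuous
  have hlocal (x₁ : F) : ∃ x : ℝ → F, x 0 = x₁ ∧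
      IsMIntegralCurveOn (I := 𝓘(ℝ, F)) x f (Ioo (-1) 1) := by
    have hpl : IsPicardLindelof (fun _ => f) (⟨0, by norm_num⟩ : Icc (-1 : ℝ) 1) x₁
        ⟨C, (norm_nonneg _).trans (hC x₀)⟩ 0 ⟨C, (norm_nonneg _).trans (hC x₀)⟩ L :=
      .of_time_independent (fun x _ => hC x) hL.lipschitzOnWith (by simp)
    obtain ⟨x, hx0, hx⟩ := hpl.exists_eq_forall_mem_Icc_hasDerivWithinAt₀
    exact ⟨x, hx0, isMIntegralCurveOn_iff_hasDerivWithinAt.2 fun t ht =>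
      (hx t (Ioo_subset_Icc_self ht)).mono Ioo_subset_Icc_self⟩
  obtain ⟨x, hx0, hx⟩ := exists_isMIntegralCurve_of_isMIntegralCurveOn (I := 𝓘(ℝ, F))
    (v := f) (contMDiff_vectorSpace_iff_contDiff.2 hf) one_pos hlocal x₀
  have hx' (t : ℝ) : HasDerivAt x (f (x t)) t :=
    (isMIntegralCurveOn_iff_hasDerivWithinAt.1 (hx.isMIntegralCurveOn univ) t trivial).hasDerivAt
      univ_mem
  exact ⟨fun t => x (t - a), by simpa using hx0, fun t => (hx' (t - a)).comp_sub_const t a⟩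

end ODE

section CutOff

variable {F : Type*} [NormedAddCommGroup F] [NormedSpace ℝ F] [FiniteDimensional ℝ F]

-- The field is multiplied by a bump function which is `1` on `C`; the product has global solutions.
theorem exists_solution_on_compact {f : F → F} (hf : ContDiff ℝ 1 f) {C : Set F} (hC : IsCompact C)
    (a : ℝ) (x₀ : F) :
    ∃ x : ℝ → F, x a = x₀ ∧ Continuous x ∧ ∀ t, x t ∈ C → HasDerivAt x (f (x t)) t := by
  obtain ⟨R, hR, hCR⟩ := hC.isBounded.subset_closedBall_lt 0 (0 : F)
  let φ : ContDiffBump (0 : F) := ⟨R, R + 1, hR, lt_add_one R⟩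
  obtain ⟨x, hx₀, hx⟩ := exists_global_solution (φ.contDiff.smul hf) φ.hasCompactSupport.smul_right
    a x₀
  refine ⟨x, hx₀, continuous_iff_continuousAt.2 fun t => (hx t).continuousAt, fun t ht => ?_⟩
  have hxt := hx t
  rwa [Pi.smul_apply', φ.one_of_mem_closedBall (hCR ht), one_smul] at hxt

end CutOff

/-! ### The closed loop near the origin -/

variable {k q m : ℕ} {S : Plant k q m} {K : Feedback k q m} {E : Matrix (Fin q) (Fin k) ℝ}
  {h ha : Vec k → Vec q} {P : Matrix (Fin q) (Fin q) ℝ}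

section ClosedLoop

variable {ρ : ℝ}

theorem norm_le_pairNorm_left {a b : ℕ} (x : Vec a) (y : Vec b) : ‖x‖ ≤ pairNorm x y :=
  Real.le_sqrt_of_sq_le (le_add_of_nonneg_right (sq_nonneg _))

theorem norm_le_pairNorm_right {a b : ℕ} (x : Vec a) (y : Vec b) : ‖y‖ ≤ pairNorm x y :=
  Real.le_sqrt_of_sq_le (le_add_of_nonneg_left (sq_nonneg _))

theorem norm_prod_le_pairNorm {a b : ℕ} (x : Vec a × Vec b) : ‖x‖ ≤ pairNorm x.1 x.2 :=
  max_le (norm_le_pairNorm_left _ _) (norm_le_pairNorm_right _ _)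

theorem pairNorm_le_add {a b : ℕ} (x : Vec a) (y : Vec b) : pairNorm x y ≤ ‖x‖ + ‖y‖ :=
  Real.sqrt_le_iff.2 ⟨by positivity, by nlinarith [norm_nonneg x, norm_nonneg y]⟩

@[fun_prop]
theorem contDiff_act {a b : ℕ} (M : Matrix (Fin a) (Fin b) ℝ) : ContDiff ℝ 1 (act M) :=
  (actL M).contDiff

@[fun_prop]
theorem contDiff_law : ContDiff ℝ 1 fun x : Vec k × Vec q => K.law x.1 x.2 := by
  have := K.Kn_contDiff
  unfold Feedback.law
  fun_prop

@[fun_prop]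
theorem contDiff_yField :
    ContDiff ℝ 1 fun x : Vec k × Vec q × Vec m => S.yField x.1 x.2.1 x.2.2 := by
  have := S.g₁_contDiff.of_le one_le_two
  unfold Plant.yField
  fun_prop

@[fun_prop]
theorem contDiff_zField :
    ContDiff ℝ 1 fun x : Vec k × Vec q × Vec m => S.zField x.1 x.2.1 x.2.2 := by
  have := S.g₂_contDiff.of_le one_le_two
  unfold Plant.zField
  fun_prop

@[simp]
theorem law_zero : K.law 0 0 = 0 := by simp [Feedback.law, K.Kn_zero]

variable (S K E) in
/-- The arguments `(y, z, u)` of the plant at the state `(y, v)` with measurement error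
`(e_y, e_v)`, for `X = ((y, v), (e_y, e_v))`. -/
noncomputable def loopArg (X : (Vec k × Vec q) × (Vec k × Vec q)) : Vec k × Vec q × Vec m :=
  (X.1.1, X.1.2 + act E X.1.1, K.law (X.1.1 + X.2.1) (X.1.2 + X.2.2 + act E (X.1.1 + X.2.1)))

@[fun_prop]
theorem contDiff_loopArg : ContDiff ℝ 1 (loopArg K E) := by
  unfold loopArg
  fun_prop

@[simp]
theorem loopArg_zero : loopArg K E 0 = 0 := by simp [loopArg]

variable (S K E) in
/-- The closed-loop vector field of the state `(y, v)` in the absence of measurement errors. -/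
noncomputable def closedLoop (x : Vec k × Vec q) : Vec k × Vec q :=
  (yRate S K E x.1 x.2 0 0, vRate S K E x.1 x.2 0 0)

theorem contDiff_closedLoop : ContDiff ℝ 1 (closedLoop S K E) := by
  unfold closedLoop vRate yRate
  fun_prop

theorem IsCenterManifold.hasFDerivAt (hh : IsCenterManifold S K E h ρ) {y : Vec k}
    (hy : y ∈ Metric.ball 0 ρ) : HasFDerivAt h (fderiv ℝ h y) y :=
  ((hh.contDiffOn.differentiableOn one_ne_zero).differentiableAt
    (Metric.isOpen_ball.mem_nhds hy)).hasFDerivAt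

theorem IsCenterManifold.continuousAt_fderiv (hh : IsCenterManifold S K E h ρ) :
    ContinuousAt (fderiv ℝ h) 0 :=
  (hh.contDiffOn.continuousOn_fderiv_of_isOpen Metric.isOpen_ball le_rfl).continuousAt
    (Metric.ball_mem_nhds 0 hh.radius_pos)

-- The solution through `(y, h y)` stays on the graph of `h`, so `v = h(y)` can be differentiated
-- along it at time `0`.
theorem IsCenterManifold.vRate_eq_fderiv (hh : IsCenterManifold S K E h ρ) {y : Vec k}
    (hy : y ∈ Metric.ball 0 ρ) :
    vRate S K E y (h y) 0 0 = fderiv ℝ h y (yRate S K E y (h y) 0 0) := by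
  obtain ⟨T, hT, x, hx0, hx⟩ := exists_local_solution
    (contDiff_closedLoop (S := S) (K := K) (E := E)) (x₀ := (y, h y))
    (continuousAt_fst.preimage_mem_nhds (Metric.isOpen_ball.mem_nhds hy))
  have hderiv (t : ℝ) (ht : t ∈ Ico 0 T) :=
    hasDerivWithinAt_prod.1 ((hx t ht).2.hasDerivWithinAt (s := Ico 0 T))
  have hinv := hh.invariant T (fun t => (x t).1) (fun t => (x t).2) hT (fun t ht => (hx t ht).1)
    (fun t ht => (hderiv t ht).1) (fun t ht => (hderiv t ht).2) (by rw [hx0])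
  have h0 : (0 : ℝ) ∈ Ico 0 T := ⟨le_rfl, hT⟩
  have hgraph : HasDerivWithinAt (fun t => h (x t).1)
      (fderiv ℝ h (x 0).1 (closedLoop S K E (x 0)).1) (Ico 0 T) 0 :=
    (hh.hasFDerivAt (hx 0 h0).1).comp_hasDerivWithinAt 0 (hderiv 0 h0).1
  have := (uniqueDiffOn_Ico (0 : ℝ) T 0 h0).eq_deriv _ (hderiv 0 h0).2
    (hgraph.congr hinv (hinv 0 h0))
  rwa [hx0] at this

theorem hasStrictFDerivAt_comp_of_fderiv_eq_zero {F G H : Type*}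
    [NormedAddCommGroup F] [NormedSpace ℝ F] [NormedAddCommGroup G] [NormedSpace ℝ G]
    [NormedAddCommGroup H] [NormedSpace ℝ H] {g : G → H} {f : F → G} {x : F}
    (hg : ContDiff ℝ 1 g) (hg0 : fderiv ℝ g (f x) = 0) (hf : ContDiff ℝ 1 f) :
    HasStrictFDerivAt (fun x => g (f x)) (0 : F →L[ℝ] H) x := by
  have hcomp := (hg.contDiffAt.hasStrictFDerivAt one_ne_zero).comp x
    (hf.contDiffAt.hasStrictFDerivAt one_ne_zero)
  rwa [hg0, ContinuousLinearMap.zero_comp] at hcomp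

theorem yRate_eq (hA₁ : S.A₁ = 0) (X : (Vec k × Vec q) × (Vec k × Vec q)) :
    yRate S K E X.1.1 X.1.2 X.2.1 X.2.2 = S.g₁ (loopArg K E X) := by
  simp [yRate, Plant.yField, hA₁, loopArg]

theorem yRate_eq_reducedG₁ (hA₁ : S.A₁ = 0) (y : Vec k) :
    yRate S K E y (h y) 0 0 = reducedG₁ S K E h y := by
  simp [yRate, reducedG₁, Plant.yField, hA₁]

theorem hasStrictFDerivAt_g₁_loopArg :
    HasStrictFDerivAt (fun X => S.g₁ (loopArg K E X)) (0 : _ →L[ℝ] Vec k) 0 :=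
  hasStrictFDerivAt_comp_of_fderiv_eq_zero (S.g₁_contDiff.of_le one_le_two)
    (by rw [loopArg_zero, S.g₁_deriv]) contDiff_loopArg

variable (S K E) in
/-- The part of the `v` equation of the closed loop which is of higher order at the origin. -/
noncomputable def vRem (X : (Vec k × Vec q) × (Vec k × Vec q)) : Vec q :=
  act S.B₂ (K.Kn (X.1.1 + X.2.1)) + S.g₂ (loopArg K E X) - act E (S.g₁ (loopArg K E X))

theorem hasStrictFDerivAt_vRem (hKn : ∀ η : Vec k, act S.B₂ (fderiv ℝ K.Kn 0 η) = 0) :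
    HasStrictFDerivAt (vRem S K E) (0 : _ →L[ℝ] Vec q) 0 := by
  have hBKn : fderiv ℝ (fun y => act S.B₂ (K.Kn y)) 0 = 0 := by
    have hKn' := ((K.Kn_contDiff.differentiable one_ne_zero) 0).hasFDerivAt
    exact ((actL S.B₂).hasFDerivAt.comp 0 hKn').fderiv.trans (ContinuousLinearMap.ext hKn)
  have h₁ : HasStrictFDerivAt (fun X : (Vec k × Vec q) × (Vec k × Vec q) =>
      act S.B₂ (K.Kn (X.1.1 + X.2.1))) (0 : _ →L[ℝ] Vec q) 0 :=
    hasStrictFDerivAt_comp_of_fderiv_eq_zero (g := fun y => act S.B₂ (K.Kn y))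
      (f := fun X : (Vec k × Vec q) × (Vec k × Vec q) => X.1.1 + X.2.1)
      ((contDiff_act _).comp K.Kn_contDiff) (by simpa using hBKn) (by fun_prop)
  have h₂ : HasStrictFDerivAt (fun X => S.g₂ (loopArg K E X)) (0 : _ →L[ℝ] Vec q) 0 :=
    hasStrictFDerivAt_comp_of_fderiv_eq_zero (S.g₂_contDiff.of_le one_le_two)
      (by rw [loopArg_zero, S.g₂_deriv]) contDiff_loopArg
  have h₃ := (actL E).hasStrictFDerivAt.comp 0
    (hasStrictFDerivAt_g₁_loopArg (S := S) (K := K) (E := E))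
  rw [ContinuousLinearMap.comp_zero] at h₃
  have hsum := (h₁.add h₂).sub h₃
  rwa [add_zero, sub_zero] at hsum

variable (S K E) in
/-- The term `B₂ K₁ e` through which the measurement error `e = (e_y, e_v)` enters the linear part
of the closed loop. -/
noncomputable def errorInput (e : Vec k × Vec q) : Vec q :=
  act (S.B₂ * (K.K₁₂ + K.K₁₁ * E)) e.1 + act (S.B₂ * K.K₁₁) e.2

theorem vRate_eq (hA₁ : S.A₁ = 0) (hE : AK S K * E - E * S.A₁ + S.B₂ * K.K₁₂ = 0)
    (X : (Vec k × Vec q) × (Vec k × Vec q)) :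
    vRate S K E X.1.1 X.1.2 X.2.1 X.2.2 =
      act (AK S K) X.1.2 + errorInput S K E X.2 + vRem S K E X := by
  have hEy : act (AK S K * E + S.B₂ * K.K₁₂) X.1.1 = 0 := by
    rw [hA₁, Matrix.mul_zero, sub_zero] at hE
    rw [hE, zero_act]
  simp only [AK, Matrix.add_mul, add_act, mul_act] at hEy
  rw [vRate, yRate_eq hA₁]
  simp only [vRem, errorInput, Plant.zField, Feedback.law, loopArg, AK, add_act, mul_act, act_add]
  rw [← sub_eq_zero, ← hEy]
  abel

theorem IsCenterManifold.wRate_eq (hh : IsCenterManifold S K E h ρ) (hA₁ : S.A₁ = 0)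
    (hE : AK S K * E - E * S.A₁ + S.B₂ * K.K₁₂ = 0) {y : Vec k} (hy : y ∈ Metric.ball 0 ρ)
    (w : Vec q) (e : Vec k × Vec q) :
    wRate S K E h y w e.1 e.2 = act (AK S K) w + errorInput S K E e +
      (vRem S K E ((y, w + h y), e) - vRem S K E ((y, h y), 0) -
        fderiv ℝ h y (yRate S K E y (w + h y) e.1 e.2 - reducedG₁ S K E h y)) := by
  have hinv := hh.vRate_eq_fderiv hy
  have hgraph := vRate_eq hA₁ hE ((y, h y), 0)
  simp only [Prod.fst_zero, Prod.snd_zero, errorInput, act_zero, add_zero] at hgraph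
  rw [wRate, vRate_eq hA₁ hE ((y, w + h y), e), ← yRate_eq_reducedG₁ hA₁, map_sub, ← hinv, hgraph,
    act_add]
  abel

theorem eventually_norm_sub_le_of_hasStrictFDerivAt_zero {A B C G : Type*}
    [NormedAddCommGroup A] [NormedSpace ℝ A] [NormedAddCommGroup B] [NormedSpace ℝ B]
    [NormedAddCommGroup C] [NormedSpace ℝ C] [NormedAddCommGroup G] [NormedSpace ℝ G]
    {f : (A × B) × C → G} (hf : HasStrictFDerivAt f (0 : _ →L[ℝ] G) 0) {h : A → B}
    (hc : ContinuousAt h 0) (h0 : h 0 = 0) {ε : ℝ} (hε : 0 < ε) :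
    ∀ᶠ X : (A × B) × C in 𝓝 0,
      ‖f ((X.1.1, X.1.2 + h X.1.1), X.2) - f ((X.1.1, h X.1.1), 0)‖ ≤ ε * (‖X.1.2‖ + ‖X.2‖) := by
  have : ContinuousAt (fun X : (A × B) × C => h X.1.1) 0 :=
    ContinuousAt.comp (f := fun X : (A × B) × C => X.1.1) hc (by fun_prop)
  have hlim : Tendsto (fun X : (A × B) × C =>
      (((X.1.1, X.1.2 + h X.1.1), X.2), ((X.1.1, h X.1.1), (0 : C)))) (𝓝 0) (𝓝 (0, 0)) := by
    have : ContinuousAt (fun X : (A × B) × C =>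
      (((X.1.1, X.1.2 + h X.1.1), X.2), ((X.1.1, h X.1.1), (0 : C)))) 0 := by fun_prop
    simpa [ContinuousAt, h0, Prod.mk_zero_zero] using this
  filter_upwards [hlim.eventually (hf.isLittleO.def hε)] with X hX
  have hdiff : ‖((X.1.1, X.1.2 + h X.1.1), X.2) - ((X.1.1, h X.1.1), (0 : C))‖ ≤
      ‖X.1.2‖ + ‖X.2‖ := by
    simp [Prod.norm_def]
  rw [zero_apply, sub_zero] at hX
  exact hX.trans (by gcongr)

variable (hh : IsCenterManifold S K E h ρ) (hA₁ : S.A₁ = 0)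
include hh hA₁

theorem IsCenterManifold.eventually_yRate_sub_le {ε : ℝ} (hε : 0 < ε) :
    ∀ᶠ X : (Vec k × Vec q) × (Vec k × Vec q) in 𝓝 0,
      ‖yRate S K E X.1.1 (X.1.2 + h X.1.1) X.2.1 X.2.2 - reducedG₁ S K E h X.1.1‖ ≤
        ε * (‖X.1.2‖ + ‖X.2‖) := by
  filter_upwards [eventually_norm_sub_le_of_hasStrictFDerivAt_zero hasStrictFDerivAt_g₁_loopArg
    (hh.hasFDerivAt (Metric.mem_ball_self hh.radius_pos)).continuousAt hh.zero hε] with X hX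
  rwa [← yRate_eq hA₁, ← yRate_eq hA₁, Prod.fst_zero, Prod.snd_zero, yRate_eq_reducedG₁ hA₁] at hX

theorem IsCenterManifold.eventually_wRate_sub_le
    (hKn : ∀ η : Vec k, act S.B₂ (fderiv ℝ K.Kn 0 η) = 0)
    (hE : AK S K * E - E * S.A₁ + S.B₂ * K.K₁₂ = 0) {ε : ℝ} (hε : 0 < ε) :
    ∀ᶠ X : (Vec k × Vec q) × (Vec k × Vec q) in 𝓝 0,
      ‖wRate S K E h X.1.1 X.1.2 X.2.1 X.2.2 -
        (act (AK S K) X.1.2 + errorInput S K E X.2)‖ ≤ ε * (‖X.1.2‖ + ‖X.2‖) := by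
  have hproj : Tendsto (fun X : (Vec k × Vec q) × (Vec k × Vec q) => X.1.1) (𝓝 0) (𝓝 0) :=
    (continuous_fst.comp continuous_fst).tendsto' _ _ rfl
  have hDh : ∀ᶠ y in 𝓝 (0 : Vec k), ‖fderiv ℝ h y‖ < 1 :=
    hh.continuousAt_fderiv.norm.eventually_lt_const (by simp [hh.deriv_zero])
  filter_upwards [hproj.eventually hDh,
    hproj.eventually (Metric.ball_mem_nhds 0 hh.radius_pos),
    hh.eventually_yRate_sub_le hA₁ (half_pos hε),
    eventually_norm_sub_le_of_hasStrictFDerivAt_zero (hasStrictFDerivAt_vRem hKn)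
      (hh.hasFDerivAt (Metric.mem_ball_self hh.radius_pos)).continuousAt hh.zero (half_pos hε)]
    with X hDX hball hyX hvX
  rw [hh.wRate_eq hA₁ hE hball, add_sub_cancel_left]
  calc _ ≤ ε / 2 * (‖X.1.2‖ + ‖X.2‖) + 1 * (ε / 2 * (‖X.1.2‖ + ‖X.2‖)) :=
        (norm_sub_le _ _).trans (add_le_add hvX
          (((fderiv ℝ h X.1.1).le_of_opNorm_le hDX.le _).trans (by gcongr)))
    _ = ε * (‖X.1.2‖ + ‖X.2‖) := by ring

end ClosedLoop

/-! ### Decrease of the Lyapunov function -/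

section Decrease

variable {Q A : Matrix (Fin q) (Fin q) ℝ} {y : Vec k} {w : Vec q}

theorem lyap_eq : lyap P y w = wnorm 1 y + wnorm P w := by
  rw [lyap, wnorm_one, wnorm]

theorem mem_lyapSubdiff_iff {ζ : Vec k × Vec q} :
    ζ ∈ lyapSubdiff P y w ↔ IsSubgradient (wnorm 1) y ζ.1 ∧ IsSubgradient (wnorm P) w ζ.2 := by
  simp only [lyapSubdiff, mem_ofPred_eq, lyap_eq]
  refine ⟨fun hζ => ⟨fun y' => ?_, fun w' => ?_⟩, fun hζ y' w' => ?_⟩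
  · have := hζ y' w
    rw [sub_self, inner_zero_right] at this
    linarith
  · have := hζ y w'
    rw [sub_self, inner_zero_right] at this
    linarith
  · linarith [hζ.1 y', hζ.2 w']

theorem norm_act_errorInput_le (e : Vec k × Vec q) :
    ‖act P (errorInput S K E e)‖ ≤ opNorm (P * S.B₂ * K1 K E) * pairNorm e.1 e.2 := by
  let x : EuclideanSpace ℝ (Fin k ⊕ Fin q) := WithLp.toLp 2 (Sum.elim e.1 e.2)
  have hx : ‖x‖ = pairNorm e.1 e.2 := by
    simp [x, pairNorm, EuclideanSpace.norm_eq, Fintype.sum_sum_type, Real.sq_sqrt,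
      Finset.sum_nonneg, sq_nonneg]
  have hact : act P (errorInput S K E e) =
      LinearMap.toContinuousLinearMap (Matrix.toEuclideanLin (P * S.B₂ * K1 K E)) x := by
    rw [errorInput, act_add, ← mul_act, ← mul_act]
    ext i
    simp only [act, K1, x, LinearMap.coe_toContinuousLinearMap', Matrix.toLpLin_apply,
      PiLp.add_apply, ← Matrix.mul_assoc, Matrix.mul_fromCols, Matrix.fromCols_mulVec]
    simp
  rw [hact, ← hx]
  exact ContinuousLinearMap.le_opNorm _ _

theorem inner_act_act_eq_of_lyapunov (hP : P.IsHermitian)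
    (hLyap : A.transpose * P + P * A = -Q) (w : Vec q) :
    inner ℝ (act A w) (act P w) = -(inner ℝ w (act Q w) / 2) := by
  have hw : inner ℝ w (act (A.transpose * P + P * A) w) = -inner ℝ w (act Q w) := by
    rw [hLyap, neg_act, inner_neg_right]
  rw [add_act, inner_add_right, mul_act, mul_act, ← inner_act_left, inner_act_comm hP w] at hw
  linarith

section Subgradient

variable {ζ : Vec q} (hq : 0 < q) (hP : P.PosDef) (hζ : IsSubgradient (wnorm P) w ζ)
include hq hP hζ

theorem IsSubgradient.inner_act_le_of_lyapunov (hQ : Q.PosDef)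
    (hLyap : A.transpose * P + P * A = -Q) :
    inner ℝ ζ (act A w) ≤ -(lambdaMin Q / (2 * √(lambdaMax P)) * ‖w‖) := by
  rcases eq_or_ne w 0 with rfl | hw
  · simp
  have hM := Real.sqrt_pos.2 (lambdaMax_pos hq hP)
  have hlQ := lambdaMin_pos hq hQ
  rw [hζ.inner_eq hP hw, inner_act_act_eq_of_lyapunov hP.1 hLyap, neg_div, neg_le_neg_iff,
    le_div_iff₀ (wnorm_pos hP hw)]
  calc lambdaMin Q / (2 * √(lambdaMax P)) * ‖w‖ * wnorm P w
      ≤ lambdaMin Q / (2 * √(lambdaMax P)) * ‖w‖ * (√(lambdaMax P) * ‖w‖) := by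
        gcongr
        exact wnorm_le hP.1 w
    _ = lambdaMin Q * ‖w‖ ^ 2 / 2 := by field_simp
    _ ≤ inner ℝ w (act Q w) / 2 := by
        gcongr
        exact lambdaMin_mul_le hQ.1 w

theorem IsSubgradient.inner_le_norm_act_div (b : Vec q) :
    inner ℝ ζ b ≤ ‖act P b‖ / √(lambdaMin P) := by
  refine (hζ.inner_le_wnorm hP.posSemidef b).trans ?_
  rw [le_div_iff₀' (Real.sqrt_pos.2 (lambdaMin_pos hq hP))]
  exact sqrt_lambdaMin_mul_wnorm_le hP.posSemidef b

end Subgradient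

theorem IsSubgradient.inner_le_neg_rpow {g ζ : Vec k} {p c : ℝ} (hp : 0 < p)
    (hζ : IsSubgradient (wnorm 1) y ζ) (hg0 : y = 0 → g = 0)
    (hg : inner ℝ y g ≤ -c * ‖y‖ ^ (p + 1)) : inner ℝ ζ g ≤ -c * ‖y‖ ^ p := by
  rcases eq_or_ne y 0 with rfl | hy
  · simp [hg0 rfl, Real.zero_rpow hp.ne']
  have hy' : 0 < ‖y‖ := norm_pos_iff.2 hy
  rwa [hζ.inner_eq .one hy, wnorm_one, one_act, real_inner_comm, div_le_iff₀ hy', mul_assoc,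
    ← Real.rpow_add_one hy'.ne']

theorem reducedG₁_zero (h0 : h 0 = 0) : reducedG₁ S K E h 0 = 0 := by
  simp only [reducedG₁, h0, act_zero, add_zero, law_zero, Prod.mk_zero_zero, S.g₁_zero]

theorem inner_add_inner_le_of_mem_lyapSubdiff (hq : 0 < q) (hP : P.PosDef) (hQ : Q.PosDef)
    (hLyap : (AK S K).transpose * P + P * AK S K = -Q) (h0 : h 0 = 0) {p c : ℝ} (hp : 0 < p)
    (hg : inner ℝ y (reducedG₁ S K E h y) ≤ -c * ‖y‖ ^ (p + 1)) {e : Vec k × Vec q}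
    {y' : Vec k} {w' : Vec q} {ζ : Vec k × Vec q}
    (hζ : ζ ∈ lyapSubdiff P y w) {r : ℝ} (hy' : ‖y' - reducedG₁ S K E h y‖ ≤ r)
    (hw' : ‖w' - (act (AK S K) w + errorInput S K E e)‖ ≤ r) :
    inner ℝ ζ.1 y' + inner ℝ ζ.2 w' ≤ -c * ‖y‖ ^ p
      - lambdaMin Q / (2 * √(lambdaMax P)) * ‖w‖
      + opNorm (P * S.B₂ * K1 K E) / √(lambdaMin P) * pairNorm e.1 e.2
      + (1 + √(lambdaMax P)) * r := by
  obtain ⟨hζy, hζw⟩ := mem_lyapSubdiff_iff.1 hζ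
  have hred := hζy.inner_le_neg_rpow hp (fun hy => by rw [hy, reducedG₁_zero h0]) hg
  have hyrem := (hζy.inner_le_wnorm .one (y' - reducedG₁ S K E h y)).trans_eq (wnorm_one _)
  have hlin := hζw.inner_act_le_of_lyapunov hq hP hQ hLyap
  have herr : inner ℝ ζ.2 (errorInput S K E e) ≤
      opNorm (P * S.B₂ * K1 K E) / √(lambdaMin P) * pairNorm e.1 e.2 := by
    refine (hζw.inner_le_norm_act_div hq hP _).trans ?_
    rw [div_mul_eq_mul_div]
    gcongr
    exact norm_act_errorInput_le e
  have hwrem : inner ℝ ζ.2 (w' - (act (AK S K) w + errorInput S K E e)) ≤ √(lambdaMax P) * r :=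
    ((hζw.inner_le_wnorm hP.posSemidef _).trans (wnorm_le hP.1 _)).trans (by gcongr)
  rw [inner_sub_right] at hyrem hwrem
  rw [inner_add_right] at hwrem
  linarith

theorem exists_small_gain {β γ c σ : ℝ} (hβ : 0 ≤ β) (hc : 0 < c) (hσ : 0 ≤ σ)
    (hgain : β * σ < γ) :
    ∃ ε > 0, ∃ η > 0, ∃ c' > 0, ∀ Y W e : ℝ, e ≤ σ * W + η * Y →
      -c * Y - γ * W + β * e + ε * (W + e) ≤ -(c / 2 * Y + c' * W) := by
  have hθ : 0 < γ - β * σ := sub_pos.2 hgain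
  obtain ⟨ε, hε, hεθ⟩ : ∃ ε > 0, ε * (1 + σ) = (γ - β * σ) / 2 :=
    ⟨(γ - β * σ) / 2 / (1 + σ), by positivity, div_mul_cancel₀ _ (by positivity)⟩
  obtain ⟨η, hη, hηc⟩ : ∃ η > 0, (β + ε) * η = c / 2 :=
    ⟨c / 2 / (β + ε), by positivity, mul_div_cancel₀ _ (by positivity)⟩
  refine ⟨ε, hε, η, hη, (γ - β * σ) / 2, half_pos hθ, fun Y W e he => ?_⟩
  calc -c * Y - γ * W + β * e + ε * (W + e) = -c * Y - γ * W + ε * W + (β + ε) * e := by ring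
    _ ≤ -c * Y - γ * W + ε * W + (β + ε) * (σ * W + η * Y) := by gcongr
    _ = -c * Y + (β + ε) * η * Y - (γ - β * σ) * W + ε * (1 + σ) * W := by ring
    _ = -(c / 2 * Y + (γ - β * σ) / 2 * W) := by rw [hεθ, hηc]; ring

theorem isLittleO_norm_rpow {F : Type*} [NormedAddCommGroup F] {p s : ℝ} (hp : 0 < p)
    (hs : p < s) : (fun y : F => ‖y‖ ^ s) =o[𝓝 0] fun y => ‖y‖ ^ p := by
  have hlim : Tendsto (fun y : F => ‖y‖ ^ (s - p)) (𝓝 0) (𝓝 0) := by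
    have hsp : 0 < s - p := sub_pos.2 hs
    exact (continuous_norm.rpow_const fun _ => .inr hsp.le).tendsto' _ _
      (by rw [norm_zero, Real.zero_rpow hsp.ne'])
  refine isLittleO_iff_exists_eq_mul.2 ⟨_, hlim, .of_forall fun y => ?_⟩
  rw [Pi.mul_apply, ← Real.rpow_add' (norm_nonneg y) (by linarith), sub_add_cancel]

theorem eventually_trigger_le {p s σ η : ℝ} (hp : 0 < p) (hs : p < s)
    (hha : (fun y => h y - ha y) =O[𝓝 0] fun y => ‖y‖ ^ s) (hσ : 0 ≤ σ) (hη : 0 < η) :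
    ∀ᶠ y in 𝓝 (0 : Vec k), ∀ w : Vec q,
      σ * (‖w + h y - ha y‖ + ‖y‖ ^ (p + 1)) ≤ σ * ‖w‖ + η * ‖y‖ ^ p := by
  have hrem : (fun y => σ * (‖h y - ha y‖ + ‖y‖ ^ (p + 1))) =o[𝓝 0] fun y => ‖y‖ ^ p :=
    ((hha.norm_left.trans_isLittleO (isLittleO_norm_rpow hp hs)).add
      (isLittleO_norm_rpow hp (lt_add_one p))).const_mul_left σ
  filter_upwards [hrem.def hη] with y hy w
  rw [Real.norm_of_nonneg (by positivity), Real.norm_of_nonneg (by positivity)] at hy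
  calc σ * (‖w + h y - ha y‖ + ‖y‖ ^ (p + 1))
      ≤ σ * (‖w‖ + ‖h y - ha y‖ + ‖y‖ ^ (p + 1)) := by
        gcongr
        rw [add_sub_assoc]
        exact norm_add_le _ _
    _ = σ * ‖w‖ + σ * (‖h y - ha y‖ + ‖y‖ ^ (p + 1)) := by ring
    _ ≤ σ * ‖w‖ + η * ‖y‖ ^ p := by gcongr

theorem eventually_forall_of_norm_le {α F : Type*} [NormedAddCommGroup F] {l : Filter α}
    {p : α × F → Prop} {φ : α → ℝ} (hp : ∀ᶠ x in l ×ˢ 𝓝 0, p x) (hφ : Tendsto φ l (𝓝 0)) :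
    ∀ᶠ a in l, ∀ e, ‖e‖ ≤ φ a → p (a, e) := by
  obtain ⟨u, hu, v, hv, huv⟩ := eventually_prod_iff.1 hp
  obtain ⟨r, hr, hrv⟩ := Metric.eventually_nhds_iff.1 hv
  filter_upwards [hu, hφ.eventually_lt_const hr] with a hua hφa e he
  exact huv hua (hrv (by rw [dist_zero_right]; exact he.trans_lt hφa))

theorem IsCenterManifold.exists_decreasesOn {ρ p c s σ : ℝ} (hh : IsCenterManifold S K E h ρ)
    (hA₁ : S.A₁ = 0) (hKn : ∀ η : Vec k, act S.B₂ (fderiv ℝ K.Kn 0 η) = 0)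
    (hE : AK S K * E - E * S.A₁ + S.B₂ * K.K₁₂ = 0) (hp : 0 < p) (hc : 0 < c)
    (hg : ∀ᶠ y in 𝓝 (0 : Vec k), inner ℝ y (reducedG₁ S K E h y) ≤ -c * ‖y‖ ^ (p + 1))
    (hs : p < s) (hha : (fun y => h y - ha y) =O[𝓝 0] fun y => ‖y‖ ^ s) (hq : 0 < q)
    (hP : P.PosDef) (hQ : Q.PosDef) (hLyap : (AK S K).transpose * P + P * AK S K = -Q)
    (hσ : 0 ≤ σ) (hgain : opNorm (P * S.B₂ * K1 K E) / √(lambdaMin P) * σ <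
      lambdaMin Q / (2 * √(lambdaMax P))) :
    ∃ δ > 0, ∃ cy > 0, ∃ cw > 0, DecreasesOn S K E h ha P σ p cy cw δ := by
  obtain ⟨ε, hε, η, hη, cw, hcw, hest⟩ :=
    exists_small_gain (div_nonneg (norm_nonneg _) (Real.sqrt_nonneg _)) hc hσ hgain
  have hM : 0 < 1 + √(lambdaMax P) := by positivity
  have hφ : Tendsto (fun x : Vec k × Vec q => σ * ‖x.2‖ + η * ‖x.1‖ ^ p) (𝓝 0) (𝓝 0) := by
    have hcont : Continuous fun x : Vec k × Vec q => σ * ‖x.2‖ + η * ‖x.1‖ ^ p := by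
      fun_prop (disch := simp [hp.le])
    exact hcont.tendsto' _ _ (by simp [Real.zero_rpow hp.ne'])
  have hrates := (hh.eventually_yRate_sub_le hA₁ (div_pos hε hM)).and
    (hh.eventually_wRate_sub_le hA₁ hKn hE (div_pos hε hM))
  rw [← Prod.mk_zero_zero, nhds_prod_eq] at hrates
  have hfst : Tendsto (fun x : Vec k × Vec q => x.1) (𝓝 0) (𝓝 0) :=
    continuous_fst.tendsto' _ _ rfl
  obtain ⟨δ, hδ, hnear⟩ := Metric.eventually_nhds_iff.1
    ((eventually_forall_of_norm_le hrates hφ).and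
      ((hfst.eventually (eventually_trigger_le hp hs hha hσ hη)).and (hfst.eventually hg)))
  refine ⟨δ, hδ, c / 2, half_pos hc, cw, hcw, fun y w ey ev hyw he ζ hζ => ?_⟩
  obtain ⟨hrate, htrig, hgy⟩ := @hnear (y, w)
    (by rw [dist_zero_right]; exact (norm_prod_le_pairNorm _).trans_lt hyw)
  have hey : pairNorm ey ev ≤ σ * ‖w‖ + η * ‖y‖ ^ p := he.trans (htrig w)
  have hle : ‖(ey, ev)‖ ≤ pairNorm ey ev := norm_prod_le_pairNorm (ey, ev)
  obtain ⟨hyr, hwr⟩ := hrate (ey, ev) (hle.trans hey)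
  have hmono : ε / (1 + √(lambdaMax P)) * (‖w‖ + ‖(ey, ev)‖) ≤
      ε / (1 + √(lambdaMax P)) * (‖w‖ + pairNorm ey ev) := by gcongr
  refine (inner_add_inner_le_of_mem_lyapSubdiff hq hP hQ hLyap hh.zero hp hgy (e := (ey, ev)) hζ
    (hyr.trans hmono) (hwr.trans hmono)).trans ?_
  rw [← mul_assoc, mul_div_cancel₀ _ hM.ne']
  exact hest _ _ _ hey

theorem gain_lt_of_le {κ lQ M μ sf σ : ℝ} (hlQ : 0 < lQ) (hM : 0 < M) (hμ : 0 < μ) (hsf : 0 < sf)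
    (hσ : σ * (2 * κ * M) ≤ (1 - sf) * lQ * μ) : κ / μ * σ < lQ / (2 * M) := by
  rw [div_mul_eq_mul_div, div_lt_div_iff₀ hμ (by positivity)]
  have : 0 < sf * (lQ * μ) := by positivity
  linarith

end Decrease

/-! ### Decay along driven curves -/

section Comparison

theorem forall_mem_of_forall_mem_Ico {X : Type*} [TopologicalSpace X] {U : Set X} (hU : IsOpen U)
    {x : ℝ → X} {a b : ℝ} (hx : ContinuousOn x (Icc a b))
    (hstep : ∀ t ∈ Icc a b, (∀ s ∈ Ico a t, x s ∈ U) → x t ∈ U) : ∀ t ∈ Icc a b, x t ∈ U := by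
  by_contra! hexit
  have hcompact : IsCompact (Icc a b ∩ x ⁻¹' Uᶜ) :=
    isCompact_Icc.of_isClosed_subset
      (hx.preimage_isClosed_of_isClosed isClosed_Icc hU.isClosed_compl) inter_subset_left
  obtain ⟨t, ⟨ht, htU⟩, hleast⟩ := hcompact.exists_isLeast hexit
  refine htU (hstep t ht fun s hs => ?_)
  by_contra hsU
  exact (hleast ⟨⟨hs.1, hs.2.le.trans ht.2⟩, hsU⟩).not_gt hs.2

theorem hasDerivWithinAt_max_affine (A B a t : ℝ) {c : ℝ} (hc : 0 ≤ c) :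
    HasDerivWithinAt (fun s => max (A - c * (s - a)) B)
      (if B < A - c * (t - a) then -c else 0) (Ici t) t := by
  split_ifs with hlt
  · have hd : HasDerivWithinAt (fun s => A - c * (s - a)) (-c) (Ici t) t := by
      simpa using ((((hasDerivAt_id t).sub_const a).const_mul c).const_sub A).hasDerivWithinAt
    have hcont : ContinuousAt (fun s => A - c * (s - a)) t := by fun_prop
    refine hd.congr_of_eventuallyEq ?_ (max_eq_left hlt.le)
    filter_upwards [nhdsWithin_le_nhds (hcont.eventually_const_lt hlt)] with s hs
    exact max_eq_left hs.le
  · rw [not_lt] at hlt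
    refine (hasDerivWithinAt_const t (Ici t) B).congr (fun s hs => max_eq_right ?_)
      (max_eq_right hlt)
    nlinarith [mem_Ici.1 hs]

theorem le_max_affine_of_deriv_right_lt {f : ℝ → ℝ} {a b A B c : ℝ} (hc : 0 ≤ c) (hBA : B ≤ A)
    (hf : ContinuousOn f (Icc a b)) (hfa : f a ≤ A)
    (hderiv : ∀ s ∈ Ico a b, ∃ d, HasDerivWithinAt f d (Ici s) s ∧
      (B ≤ f s → f s ≤ A → d < -c)) :
    ∀ s ∈ Icc a b, f s ≤ max (A - c * (s - a)) B := by
  choose! d hd hlt using hderiv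
  refine image_le_of_liminf_slope_right_lt_deriv_boundary' hf
    (fun s hs r hr => (hd s hs).liminf_right_slope_le hr) ?_ (by fun_prop)
    (fun s _ => hasDerivWithinAt_max_affine A B a s hc) fun s hs heq => ?_
  · simpa using hfa.trans (le_max_left A B)
  · have hdc := hlt s hs (heq ▸ le_max_right _ _)
      (heq ▸ max_le (sub_le_self _ (mul_nonneg hc (sub_nonneg.2 hs.1))) hBA)
    split_ifs <;> linarith

end Comparison

section Slopes

theorem slope₁_pos (hq : 0 < q) (hP : P.PosDef) : 0 < slope₁ P :=
  lt_min one_pos (Real.sqrt_pos.2 (lambdaMin_pos hq hP))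

theorem slope₂_pos : 0 < slope₂ P := by unfold slope₂; positivity

theorem slope₁_mul_le_lyap (hP : P.PosDef) (y : Vec k) (w : Vec q) :
    slope₁ P * pairNorm y w ≤ lyap P y w :=
  calc slope₁ P * pairNorm y w ≤ slope₁ P * (‖y‖ + ‖w‖) := by
        gcongr
        · exact le_min zero_le_one (Real.sqrt_nonneg _)
        · exact pairNorm_le_add y w
    _ = slope₁ P * ‖y‖ + slope₁ P * ‖w‖ := mul_add _ _ _
    _ ≤ 1 * ‖y‖ + √(lambdaMin P) * ‖w‖ := by
        gcongr
        · exact min_le_left _ _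
        · exact min_le_right _ _
    _ ≤ lyap P y w := by
        rw [lyap_eq, wnorm_one, one_mul]
        gcongr
        exact le_wnorm hP.1 w

theorem lyap_le_slope₂_mul (hP : P.IsHermitian) (y : Vec k) (w : Vec q) :
    lyap P y w ≤ slope₂ P * pairNorm y w := by
  have hadd : ‖y‖ + ‖w‖ ≤ √2 * pairNorm y w := by
    rw [pairNorm, ← Real.sqrt_mul (by norm_num)]
    apply Real.le_sqrt_of_sq_le
    linarith [sq_nonneg (‖y‖ - ‖w‖)]
  calc lyap P y w ≤ 1 * ‖y‖ + √(lambdaMax P) * ‖w‖ := by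
        rw [lyap_eq, wnorm_one, one_mul]
        gcongr
        exact wnorm_le hP w
    _ ≤ max 1 √(lambdaMax P) * ‖y‖ + max 1 √(lambdaMax P) * ‖w‖ := by
        gcongr
        · exact le_max_left _ _
        · exact le_max_right _ _
    _ = max 1 √(lambdaMax P) * (‖y‖ + ‖w‖) := by ring
    _ ≤ max 1 √(lambdaMax P) * (√2 * pairNorm y w) := by gcongr
    _ = slope₂ P * pairNorm y w := by rw [slope₂]; ring

theorem lyap_lt_of_mem_S2 (hP : P.IsHermitian) {rs : ℝ} {x : Vec k × Vec q}
    (hx : x ∈ S2 k P rs) : lyap P x.1 x.2 < slope₁ P * rs :=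
  (lyap_le_slope₂_mul hP x.1 x.2).trans_lt ((lt_div_iff₀' slope₂_pos).1 hx)

theorem continuous_lyap : Continuous fun x : Vec k × Vec q => lyap P x.1 x.2 := by
  simp only [lyap_eq]
  exact (continuous_wnorm.comp continuous_fst).add (continuous_wnorm.comp continuous_snd)

theorem continuous_pairNorm {a b : ℕ} : Continuous fun x : Vec a × Vec b => pairNorm x.1 x.2 := by
  unfold pairNorm
  fun_prop

end Slopes

/-- The coordinates `(y; w)` of the plant state `x = (y, z)`. -/
noncomputable abbrev coords (E : Matrix (Fin q) (Fin k) ℝ) (h : Vec k → Vec q)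
    (x : Vec k × Vec q) : Vec k × Vec q :=
  toYW E h x.1 x.2

/-- The norm `‖(y; w)‖` as a function of the plant state. -/
noncomputable def stateNorm (E : Matrix (Fin q) (Fin k) ℝ) (h : Vec k → Vec q)
    (x : Vec k × Vec q) : ℝ :=
  pairNorm (coords E h x).1 (coords E h x).2

/-- The Lyapunov function `V(y, w)` as a function of the plant state. -/
noncomputable def stateLyap (E : Matrix (Fin q) (Fin k) ℝ) (h : Vec k → Vec q)
    (P : Matrix (Fin q) (Fin q) ℝ) (x : Vec k × Vec q) : ℝ :=
  lyap P (coords E h x).1 (coords E h x).2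

/-- The vector field of the plant on states `(y, z)` for the constant input `u`. -/
noncomputable def plantField (S : Plant k q m) (u : Vec m) (x : Vec k × Vec q) : Vec k × Vec q :=
  (S.yField x.1 x.2 u, S.zField x.1 x.2 u)

/-- The size `‖e‖` of the measurement error when the state `x` is measured as `x'`. -/
noncomputable def measErr (E : Matrix (Fin q) (Fin k) ℝ) (x' x : Vec k × Vec q) : ℝ :=
  pairNorm (x'.1 - x.1) ((x'.2 - act E x'.1) - (x.2 - act E x.1))

/-- The bound `σ (‖wᵃ‖ + ‖y‖ ^ (p + 1))` of the triggering condition at the plant state `x`. -/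
noncomputable def threshold (E : Matrix (Fin q) (Fin k) ℝ) (ha : Vec k → Vec q) (σ p : ℝ)
    (x : Vec k × Vec q) : ℝ :=
  σ * (‖x.2 - act E x.1 - ha x.1‖ + ‖x.1‖ ^ (p + 1))

/-- At time `t` the curve `x` follows the plant with some input, and if `(y; w)` is in `D`, this
input is the feedback for a measurement whose error is within the triggering bound. -/
def IsDrivenAt (S : Plant k q m) (K : Feedback k q m) (E : Matrix (Fin q) (Fin k) ℝ)
    (h ha : Vec k → Vec q) (σ p : ℝ) (D : Set (Vec k × Vec q)) (x : ℝ → Vec k × Vec q)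
    (t : ℝ) : Prop :=
  ∃ u, HasDerivWithinAt x (plantField S u (x t)) (Ici t) t ∧ (coords E h (x t) ∈ D →
    ∃ x', u = K.law x'.1 x'.2 ∧ measErr E x' (x t) ≤ threshold E ha σ p (x t))

section Region

variable {ρ δ : ℝ} {x : Vec k × Vec q}

theorem fst_mem_ball_of_stateNorm_lt (hx : stateNorm E h x < ρ) : x.1 ∈ Metric.ball 0 ρ := by
  rw [mem_ball_zero_iff]
  exact (norm_le_pairNorm_left _ _).trans_lt hx

theorem isCompact_ballYW : IsCompact (ballYW k q δ) :=
  (isCompact_closedBall 0 δ).of_isClosed_subset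
    (isClosed_le continuous_pairNorm continuous_const)
    fun x hx => mem_closedBall_zero_iff.2 ((norm_prod_le_pairNorm x).trans hx)

variable (hh : IsCenterManifold S K E h ρ)
include hh

theorem IsCenterManifold.continuousOn_coords :
    ContinuousOn (coords E h) (Prod.fst ⁻¹' Metric.ball 0 ρ) := by
  have hcomp : ContinuousOn (fun x : Vec k × Vec q => h x.1) (Prod.fst ⁻¹' Metric.ball 0 ρ) :=
    hh.contDiffOn.continuousOn.comp continuousOn_fst fun _ hx => hx
  have hact : Continuous fun x : Vec k × Vec q => x.2 - act E x.1 := by fun_prop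
  exact continuousOn_fst.prodMk (hact.continuousOn.sub hcomp)

theorem IsCenterManifold.isOpen_stateNorm_lt (hδ : δ ≤ ρ) :
    IsOpen {x | stateNorm E h x < δ} := by
  have hopen := (continuous_pairNorm.comp_continuousOn hh.continuousOn_coords).isOpen_inter_preimage
    (Metric.isOpen_ball.preimage continuous_fst) (isOpen_Iio (a := δ))
  convert hopen using 1
  ext x
  exact ⟨fun hx => ⟨fst_mem_ball_of_stateNorm_lt (lt_of_lt_of_le hx hδ), hx⟩, fun hx => hx.2⟩

theorem IsCenterManifold.isCompact_stateNorm_le (hδ : δ < ρ) :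
    IsCompact {x | stateNorm E h x ≤ δ} := by
  have hh' : ContinuousOn (fun ξ : Vec k × Vec q => h ξ.1) (ballYW k q δ) :=
    hh.contDiffOn.continuousOn.comp continuousOn_fst fun ξ hξ =>
      mem_ball_zero_iff.2 (((norm_le_pairNorm_left _ _).trans hξ).trans_lt hδ)
  have hact : Continuous fun ξ : Vec k × Vec q => ξ.2 + act E ξ.1 := by fun_prop
  convert isCompact_ballYW.image_of_continuousOn
    (continuousOn_fst.prodMk (hact.continuousOn.add hh')) using 1
  ext x
  refine ⟨fun hx => ⟨coords E h x, hx, ?_⟩, ?_⟩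
  · simp only [toYW, Pi.add_apply, Prod.ext_iff, true_and]
    abel
  · rintro ⟨ξ, hξ, rfl⟩
    have hw : ξ.2 + act E ξ.1 + h ξ.1 - act E ξ.1 - h ξ.1 = ξ.2 := by abel
    simpa [stateNorm, toYW, hw] using show pairNorm ξ.1 ξ.2 ≤ δ from hξ

end Region

section Decay

variable {ρ δ rs σ p c cy cw t : ℝ} {x : ℝ → Vec k × Vec q}

theorem exists_rate_lt (hp : 0 ≤ p) (hcy : 0 < cy) (hcw : 0 < cw) {r : ℝ} (hr : 0 < r) :
    ∃ c > 0, ∀ (y : Vec k) (w : Vec q), r ≤ pairNorm y w → c < cy * ‖y‖ ^ p + cw * ‖w‖ := by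
  set c := min (cy * (r / 2) ^ p) (cw * (r / 2))
  have hc : 0 < c := by positivity
  refine ⟨c / 2, half_pos hc, fun y w hyw => (half_lt_self hc).trans_le ?_⟩
  have hadd := hyw.trans (pairNorm_le_add y w)
  rcases le_total (r / 2) ‖y‖ with hy | hy
  · calc c ≤ cy * (r / 2) ^ p := min_le_left _ _
      _ ≤ cy * ‖y‖ ^ p := by gcongr
      _ ≤ cy * ‖y‖ ^ p + cw * ‖w‖ := le_add_of_nonneg_right (by positivity)
  · calc c ≤ cw * (r / 2) := min_le_right _ _
      _ ≤ cw * ‖w‖ := by gcongr; linarith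
      _ ≤ cy * ‖y‖ ^ p + cw * ‖w‖ := le_add_of_nonneg_left (by positivity)

theorem exists_mem_lyapSubdiff_hasDerivWithinAt (hP : P.PosDef) {ξ : ℝ → Vec k × Vec q}
    {ξ' : Vec k × Vec q} (hξ : HasDerivWithinAt ξ ξ' (Ici t) t) :
    ∃ ζ ∈ lyapSubdiff P (ξ t).1 (ξ t).2, HasDerivWithinAt (fun s => lyap P (ξ s).1 (ξ s).2)
      (inner ℝ ζ.1 ξ'.1 + inner ℝ ζ.2 ξ'.2) (Ici t) t := by
  obtain ⟨hξ₁, hξ₂⟩ := hasDerivWithinAt_prod.1 hξ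
  obtain ⟨ζ₁, hζ₁, hd₁⟩ := exists_subgradient_hasDerivWithinAt Matrix.PosDef.one hξ₁
  obtain ⟨ζ₂, hζ₂, hd₂⟩ := exists_subgradient_hasDerivWithinAt hP hξ₂
  simp only [lyap_eq]
  exact ⟨(ζ₁, ζ₂), mem_lyapSubdiff_iff.2 ⟨hζ₁, hζ₂⟩, hd₁.add hd₂⟩

theorem IsCenterManifold.hasDerivWithinAt_coords (hh : IsCenterManifold S K E h ρ)
    {x' : Vec k × Vec q} (hx : HasDerivWithinAt x x' (Ici t) t)
    (hball : (x t).1 ∈ Metric.ball 0 ρ) :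
    HasDerivWithinAt (fun s => coords E h (x s))
      (x'.1, x'.2 - act E x'.1 - fderiv ℝ h (x t).1 x'.1) (Ici t) t := by
  obtain ⟨hy, hz⟩ := hasDerivWithinAt_prod.1 hx
  exact hy.prodMk ((hz.sub ((actL E).hasFDerivAt.comp_hasDerivWithinAt t hy)).sub
    ((hh.hasFDerivAt hball).comp_hasDerivWithinAt t hy))

theorem rates_eq_plantField (x x' : Vec k × Vec q) {v : Vec k × Vec q}
    (hv : v = plantField S (K.law x'.1 x'.2) x) :
    let ey := x'.1 - x.1
    let ev := (x'.2 - act E x'.1) - (x.2 - act E x.1)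
    yRate S K E x.1 ((coords E h x).2 + h x.1) ey ev = v.1 ∧
      wRate S K E h x.1 (coords E h x).2 ey ev = v.2 - act E v.1 - fderiv ℝ h x.1 v.1 := by
  simp [hv, plantField, wRate, vRate, yRate, toYW]

theorem exists_hasDerivWithinAt_stateLyap (hh : IsCenterManifold S K E h ρ) (hP : P.PosDef)
    (hδ : δ ≤ ρ) (hdec : DecreasesOn S K E h ha P σ p cy cw δ) {D : Set (Vec k × Vec q)}
    (hx : stateNorm E h (x t) < δ) (hd : IsDrivenAt S K E h ha σ p D x t) :
    ∃ d, HasDerivWithinAt (fun s => stateLyap E h P (x s)) d (Ici t) t ∧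
      (coords E h (x t) ∈ D →
        d ≤ -(cy * ‖(coords E h (x t)).1‖ ^ p + cw * ‖(coords E h (x t)).2‖)) := by
  obtain ⟨u, hu, hmeas⟩ := hd
  obtain ⟨ζ, hζ, hderiv⟩ := exists_mem_lyapSubdiff_hasDerivWithinAt hP
    (hh.hasDerivWithinAt_coords hu (fst_mem_ball_of_stateNorm_lt (hx.trans_le hδ)))
  refine ⟨_, hderiv, fun hD => ?_⟩
  obtain ⟨x', rfl, herr⟩ := hmeas hD
  obtain ⟨hy, hw⟩ := rates_eq_plantField (S := S) (K := K) (E := E) (h := h) (x t) x' rfl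
  have hbound := hdec (x t).1 (coords E h (x t)).2 _ _ hx
    (by simpa only [toYW, sub_add_cancel, measErr, threshold] using herr) ζ hζ
  rwa [hy, hw] at hbound

/-- Every driven curve which starts in `S_v` stays there, and `V` decreases along it at least at
the rate `c` until the level `α₁(r_s)` is reached. -/
def DecaysAtRate (S : Plant k q m) (K : Feedback k q m) (E : Matrix (Fin q) (Fin k) ℝ)
    (h ha : Vec k → Vec q) (P : Matrix (Fin q) (Fin q) ℝ) (σ p δ rs c : ℝ) : Prop :=
  ∀ (x : ℝ → Vec k × Vec q) (a b : ℝ), ContinuousOn x (Icc a b) →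
    coords E h (x a) ∈ Sv k P δ →
    (∀ t ∈ Ico a b, stateNorm E h (x t) < δ →
      IsDrivenAt S K E h ha σ p (Sv k P δ \ S2 k P rs) x t) →
    ∀ t ∈ Icc a b, coords E h (x t) ∈ Sv k P δ ∧
      stateLyap E h P (x t) ≤ max (slope₁ P * δ - c * (t - a)) (slope₁ P * rs)

section Flow

variable (hq : 0 < q) (hh : IsCenterManifold S K E h ρ) (hP : P.PosDef) (hδ : δ < ρ)
  (hdec : DecreasesOn S K E h ha P σ p cy cw δ) (hrs : rs < δ) (hc : 0 < c)
  (hrate : ∀ ξ : Vec k × Vec q, ξ ∉ S2 k P rs → c < cy * ‖ξ.1‖ ^ p + cw * ‖ξ.2‖)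
include hq hh hP hδ hdec hrs hc hrate

theorem stateLyap_le_of_stateNorm_lt {a b : ℝ} (hx : ContinuousOn x (Icc a b))
    (hx₀ : coords E h (x a) ∈ Sv k P δ) (hab : stateNorm E h (x b) ≤ δ)
    (hin : ∀ t ∈ Ico a b, stateNorm E h (x t) < δ)
    (hd : ∀ t ∈ Ico a b, IsDrivenAt S K E h ha σ p (Sv k P δ \ S2 k P rs) x t) :
    ∀ t ∈ Icc a b, stateLyap E h P (x t) ≤ max (slope₁ P * δ - c * (t - a)) (slope₁ P * rs) := by
  have hball : MapsTo x (Icc a b) (Prod.fst ⁻¹' Metric.ball 0 ρ) := fun t ht => by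
    rcases ht.2.eq_or_lt with rfl | htb
    · exact fst_mem_ball_of_stateNorm_lt (hab.trans_lt hδ)
    · exact fst_mem_ball_of_stateNorm_lt ((hin t ⟨ht.1, htb⟩).trans hδ)
  refine le_max_affine_of_deriv_right_lt hc.le
    (mul_le_mul_of_nonneg_left hrs.le (slope₁_pos hq hP).le)
    (continuous_lyap.comp_continuousOn (hh.continuousOn_coords.comp hx hball)) hx₀.2
    fun t ht => ?_
  obtain ⟨d, hderiv, hle⟩ :=
    exists_hasDerivWithinAt_stateLyap hh hP hδ.le hdec (hin t ht) (hd t ht)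
  refine ⟨d, hderiv, fun hge hSv => ?_⟩
  have hS2 : coords E h (x t) ∉ S2 k P rs := fun hS2 => (lyap_lt_of_mem_S2 hP.1 hS2).not_ge hge
  exact (hle ⟨⟨hin t ht, hSv⟩, hS2⟩).trans_lt (neg_lt_neg (hrate _ hS2))

theorem DecreasesOn.decaysAtRate : DecaysAtRate S K E h ha P σ p δ rs c := by
  intro x a b hx hx₀ hd
  have hlevel (t : ℝ) (hat : a ≤ t) :
      max (slope₁ P * δ - c * (t - a)) (slope₁ P * rs) ≤ slope₁ P * δ :=
    max_le (sub_le_self _ (mul_nonneg hc.le (sub_nonneg.2 hat)))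
      (mul_le_mul_of_nonneg_left hrs.le (slope₁_pos hq hP).le)
  have hin : ∀ t ∈ Icc a b, stateNorm E h (x t) < δ := by
    refine forall_mem_of_forall_mem_Ico (hh.isOpen_stateNorm_lt hδ.le) hx fun t ht hbefore => ?_
    rcases ht.1.eq_or_lt with rfl | hat
    · exact hx₀.1
    have hxt : ContinuousOn x (Icc a t) := hx.mono (Icc_subset_Icc_right ht.2)
    have hle : stateNorm E h (x t) ≤ δ := by
      rw [← mem_ofPred_eq (p := fun x => stateNorm E h x ≤ δ),
        ← (hh.isCompact_stateNorm_le hδ).isClosed.closure_eq]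
      refine ((hxt t ⟨hat.le, le_rfl⟩).mono Ico_subset_Icc_self).mem_closure ?_
        fun s hs => show stateNorm E h (x s) ≤ δ from (hbefore s hs).le
      rw [closure_Ico hat.ne]
      exact ⟨hat.le, le_rfl⟩
    have hdecay := stateLyap_le_of_stateNorm_lt hq hh hP hδ hdec hrs hc hrate hxt hx₀ hle hbefore
      (fun s hs => hd s ⟨hs.1, hs.2.trans_le ht.2⟩ (hbefore s hs)) t ⟨hat.le, le_rfl⟩
    have hlt : max (slope₁ P * δ - c * (t - a)) (slope₁ P * rs) < slope₁ P * δ :=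
      max_lt (sub_lt_self _ (mul_pos hc (sub_pos.2 hat)))
        (mul_lt_mul_of_pos_left hrs (slope₁_pos hq hP))
    exact lt_of_mul_lt_mul_left (((slope₁_mul_le_lyap hP _ _).trans hdecay).trans_lt hlt)
      (slope₁_pos hq hP).le
  intro t ht
  have hdecay := stateLyap_le_of_stateNorm_lt hq hh hP hδ hdec hrs hc hrate hx hx₀
    (hin b ⟨ht.1.trans ht.2, le_rfl⟩).le (fun s hs => hin s ⟨hs.1, hs.2.le⟩)
    (fun s hs => hd s hs (hin s ⟨hs.1, hs.2.le⟩)) t ht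
  exact ⟨⟨hin t ht, hdecay.trans (hlevel t ht.1)⟩, hdecay⟩

end Flow

end Decay

/-! ### The time between two events -/

section EventGap

variable {ρ δ r σ p : ℝ}

@[fun_prop]
theorem contDiff_plantField :
    ContDiff ℝ 1 fun X : Vec m × (Vec k × Vec q) => plantField S X.1 X.2 := by
  unfold plantField
  fun_prop

theorem measErr_le (x' x : Vec k × Vec q) : measErr E x' x ≤ (2 + ‖actL E‖) * ‖x' - x‖ := by
  have hy : ‖x'.1 - x.1‖ ≤ ‖x' - x‖ := norm_fst_le (x' - x)
  have hz : ‖x'.2 - x.2‖ ≤ ‖x' - x‖ := norm_snd_le (x' - x)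
  have hv : ‖(x'.2 - act E x'.1) - (x.2 - act E x.1)‖ ≤ ‖x' - x‖ + ‖actL E‖ * ‖x' - x‖ := by
    rw [sub_sub_sub_comm, ← act_sub]
    exact (norm_sub_le _ _).trans (add_le_add hz (((actL E).le_opNorm _).trans (by gcongr)))
  exact (pairNorm_le_add _ _).trans (by linarith)

theorem continuous_measErr (x' : Vec k × Vec q) : Continuous (measErr E x') := by
  unfold measErr pairNorm
  fun_prop

theorem continuous_threshold (hha : Continuous ha) (hp : 0 ≤ p) :
    Continuous (threshold E ha σ p) := by
  unfold threshold
  have hpow : Continuous fun x : Vec k × Vec q => ‖x.1‖ ^ (p + 1) :=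
    continuous_fst.norm.rpow_const fun _ => Or.inr (by linarith)
  fun_prop

theorem threshold_pos (hσ : 0 < σ) (hp : 0 ≤ p) (h0 : h 0 = ha 0) {x : Vec k × Vec q}
    (hx : 0 < stateNorm E h x) : 0 < threshold E ha σ p x := by
  refine mul_pos hσ ((add_nonneg (norm_nonneg _) (Real.rpow_nonneg (norm_nonneg _) _)).lt_of_ne'
    fun hzero => hx.ne' ?_)
  obtain ⟨hw, hy⟩ := (add_eq_zero_iff_of_nonneg (norm_nonneg _) (by positivity)).1 hzero
  have hy0 : x.1 = 0 := norm_eq_zero.1 ((Real.rpow_eq_zero (norm_nonneg _) (by linarith)).1 hy)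
  have hw0 : x.2 - h 0 = 0 := by simpa [hy0, h0] using hw
  simp [stateNorm, toYW, hy0, hw0, pairNorm]

/-- A lower bound `g` on the time between two events: if the input is held at the feedback for
the state at time `a` and the curve remains in the region `‖(y; w)‖ ≤ δ`, then the triggering
inequality cannot hold outside the ball of radius `r` before the time `a + g`. -/
def HasEventGap (S : Plant k q m) (K : Feedback k q m) (E : Matrix (Fin q) (Fin k) ℝ)
    (h ha : Vec k → Vec q) (σ p δ r g : ℝ) : Prop :=
  ∀ (x : ℝ → Vec k × Vec q) (a b : ℝ), a ≤ b → ContinuousOn x (Icc a b) →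
    (∀ t ∈ Ico a b,
      HasDerivWithinAt x (plantField S (K.law (x a).1 (x a).2) (x t)) (Ici t) t) →
    (∀ t ∈ Icc a b, stateNorm E h (x t) ≤ δ) → r ≤ stateNorm E h (x b) →
    threshold E ha σ p (x b) ≤ measErr E (x a) (x b) → a + g ≤ b

variable (hh : IsCenterManifold S K E h ρ)
include hh

theorem IsCenterManifold.isCompact_annulus (hδ : δ < ρ) (hr : r ≤ ρ) :
    IsCompact {x | stateNorm E h x ≤ δ ∧ r ≤ stateNorm E h x} := by
  convert (hh.isCompact_stateNorm_le hδ).diff (hh.isOpen_stateNorm_lt hr) using 1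
  ext x
  simp

theorem IsCenterManifold.exists_hasEventGap (hδ : δ < ρ) (hr : 0 < r) (hrρ : r ≤ ρ) (hσ : 0 < σ)
    (hp : 0 ≤ p) (hha : Continuous ha) (h0 : h 0 = ha 0) :
    ∃ g > 0, HasEventGap S K E h ha σ p δ r g := by
  have hC := hh.isCompact_stateNorm_le hδ
  have hfield : Continuous fun X : (Vec k × Vec q) × (Vec k × Vec q) =>
      plantField S (K.law X.1.1 X.1.2) X.2 :=
    (contDiff_plantField.comp ((contDiff_law.comp contDiff_fst).prodMk contDiff_snd)).continuous
  obtain ⟨M, hM⟩ := (hC.prod hC).exists_bound_of_continuousOn hfield.continuousOn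
  obtain ⟨η, hη, hle⟩ := (hh.isCompact_annulus hδ hrρ).exists_forall_le'
    (continuous_threshold (E := E) (σ := σ) hha hp).continuousOn
    fun x hx => threshold_pos hσ hp h0 (hr.trans_le hx.2)
  set L := (2 + ‖actL E‖) * (|M| + 1)
  have hL : 0 < L := by positivity
  refine ⟨η / L, by positivity, fun x a b hab hx hd hδx hrx htrig => ?_⟩
  have hmove : ‖x b - x a‖ ≤ (|M| + 1) * (b - a) := by
    refine norm_image_sub_le_of_norm_deriv_right_le_segment hx hd (fun t ht => ?_) b ⟨hab, le_rfl⟩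
    have hbound := hM (x a, x t) ⟨hδx a ⟨le_rfl, hab⟩, hδx t ⟨ht.1, ht.2.le⟩⟩
    linarith [le_abs_self M]
  have hηL : η ≤ L * (b - a) :=
    calc η ≤ threshold E ha σ p (x b) := hle _ ⟨hδx b ⟨hab, le_rfl⟩, hrx⟩
      _ ≤ (2 + ‖actL E‖) * ‖x a - x b‖ := htrig.trans (measErr_le _ _)
      _ ≤ (2 + ‖actL E‖) * ((|M| + 1) * (b - a)) := by rw [norm_sub_rev]; gcongr
      _ = L * (b - a) := (mul_assoc _ _ _).symm
  have := (div_le_iff₀' hL).2 hηL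
  linarith

end EventGap

/-! ### Trajectories as concatenations of arcs -/

section FirstTime

variable {D D' : Set ℝ} {a : EReal}

theorem IsFirstTime.le (ha : IsFirstTime D a) {t : ℝ} (ht : t ∈ D) : a ≤ t := by
  rcases ha with ⟨r, hr, rfl⟩ | ⟨rfl, -⟩
  · exact EReal.coe_le_coe_iff.2 (hr.2 ht)
  · exact ht.elim

theorem IsFirstTime.eq_top_or_exists_mem (ha : IsFirstTime D a) :
    a = ⊤ ∨ ∃ t ∈ D, a = (t : EReal) :=
  ha.symm.imp And.right fun ⟨r, hr, har⟩ => ⟨r, hr.1, har⟩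

theorem IsFirstTime.congr (ha : IsFirstTime D a)
    (hDD' : ∀ t : ℝ, (t : EReal) ≤ a → (t ∈ D ↔ t ∈ D')) : IsFirstTime D' a := by
  rcases ha with ⟨r, hr, rfl⟩ | ⟨rfl, rfl⟩
  · refine Or.inl ⟨r, ⟨(hDD' r le_rfl).1 hr.1, fun t ht => le_of_not_gt fun htr => ?_⟩, rfl⟩
    exact htr.not_ge (hr.2 ((hDD' t (EReal.coe_le_coe_iff.2 htr.le)).2 ht))
  · exact Or.inr ⟨eq_empty_of_forall_notMem fun t ht => (hDD' t le_top).2 ht, rfl⟩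

theorem exists_isFirstTime (hD : IsClosed D) (hbdd : BddBelow D) : ∃ a, IsFirstTime D a := by
  rcases D.eq_empty_or_nonempty with hempty | hne
  · exact ⟨⊤, Or.inr ⟨hempty, rfl⟩⟩
  · exact ⟨_, Or.inl ⟨_, hD.isLeast_csInf hne hbdd, rfl⟩⟩

end FirstTime

/-- The input after the `n`-th event when the state at that event is `x₀`; it is `0` before the
first event. -/
noncomputable def heldInput (K : Feedback k q m) : ℕ → Vec k × Vec q → Vec m
  | 0, _ => 0
  | _ + 1, x₀ => K.law x₀.1 x₀.2

/-- The states at which the triggering inequality holds after the `n`-th event, when the state at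
that event is `x₀`; there is no inequality to satisfy for the first event. -/
def triggerSet (E : Matrix (Fin q) (Fin k) ℝ) (ha : Vec k → Vec q) (σ p : ℝ) :
    ℕ → Vec k × Vec q → Set (Vec k × Vec q)
  | 0, _ => univ
  | _ + 1, x₀ => {x | threshold E ha σ p x ≤ measErr E x₀ x}

/-- The curve `x` follows the plant with the constant input `u` from the time `a` to the time `b`,
and `b` is the first time in `[a, T)` at which `x` is in `C`. -/
structure IsArc (S : Plant k q m) (u : Vec m) (C : Set (Vec k × Vec q)) (T a b : EReal)
    (x : ℝ → Vec k × Vec q) : Prop where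
  first_time : IsFirstTime {t : ℝ | a ≤ t ∧ (t : EReal) < T ∧ x t ∈ C} b
  follows : ∀ t : ℝ, a ≤ t → (t : EReal) < T → (t : EReal) < b →
    HasDerivWithinAt x (plantField S u (x t)) (Ici t) t

section Arc

variable {σ p δ r g : ℝ} {u : Vec m} {C D : Set (Vec k × Vec q)}
  {T a b : EReal} {x x' : ℝ → Vec k × Vec q} {x₀ x₁ : Vec k × Vec q} {n : ℕ}

theorem exists_law_eq_heldInput (hx : x₁ ∉ triggerSet E ha σ p n x₀) :
    ∃ x', heldInput K n x₀ = K.law x'.1 x'.2 ∧ measErr E x' x₁ ≤ threshold E ha σ p x₁ := by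
  rcases n with - | n
  · exact absurd (mem_univ x₁) hx
  · exact ⟨x₀, rfl, (not_le.1 hx).le⟩

theorem isClosed_triggerSet (hha : Continuous ha) (hp : 0 ≤ p) :
    IsClosed (triggerSet E ha σ p n x₀) := by
  rcases n with - | _
  · exact isClosed_univ
  · exact isClosed_le (continuous_threshold hha hp) (continuous_measErr x₀)

theorem isArc_top : IsArc S u C T ⊤ ⊤ x where
  first_time :=
    Or.inr ⟨eq_empty_of_forall_notMem fun t ht => (EReal.coe_lt_top t).not_ge ht.1, rfl⟩
  follows t ht := absurd ht (EReal.coe_lt_top t).not_ge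

theorem IsArc.le (harc : IsArc S u C T a b x) : a ≤ b := by
  rcases harc.first_time.eq_top_or_exists_mem with rfl | ⟨t, ht, rfl⟩
  · exact le_top
  · exact ht.1

theorem IsArc.congr (harc : IsArc S u C T a b x)
    (hxx' : ∀ t : ℝ, a ≤ t → (t : EReal) ≤ b → x' t = x t) : IsArc S u C T a b x' where
  first_time := harc.first_time.congr fun t htb =>
    and_congr_right fun hat => by rw [hxx' t hat htb]
  follows t hat htT htb := by
    have hnear : x' =ᶠ[𝓝[Ici t] t] x := by
      filter_upwards [self_mem_nhdsWithin, nhdsWithin_le_nhds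
        (continuous_coe_real_ereal.continuousAt.eventually_lt_const htb)] with s hts hsb
      exact hxx' s (hat.trans (EReal.coe_le_coe_iff.2 hts)) hsb.le
    rw [hxx' t hat htb.le]
    exact (harc.follows t hat htT htb).congr_of_eventuallyEq hnear (hxx' t hat htb.le)

theorem IsArc.add_le {a : ℝ} (harc : IsArc S (heldInput K (n + 1) (x a))
      (triggerSet E ha σ p (n + 1) (x a) ∩ coords E h ⁻¹' D) T a b x)
    (hgap : HasEventGap S K E h ha σ p δ r g) (hD : ∀ ξ ∈ D, r ≤ pairNorm ξ.1 ξ.2)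
    (hx : ContinuousOn x {t | a ≤ t ∧ (t : EReal) < T})
    (hδ : ∀ t : ℝ, a ≤ t → (t : EReal) < T → (t : EReal) ≤ b → stateNorm E h (x t) ≤ δ) :
    (a : EReal) + (g : EReal) ≤ b := by
  rcases harc.first_time.eq_top_or_exists_mem with rfl | ⟨b, ⟨hab, hbT, htrig, hmem⟩, rfl⟩
  · exact le_top
  have hltT {t : ℝ} (ht : t ≤ b) : (t : EReal) < T := (EReal.coe_le_coe_iff.2 ht).trans_lt hbT
  rw [← EReal.coe_add, EReal.coe_le_coe_iff]
  exact hgap x a b (EReal.coe_le_coe_iff.1 hab) (hx.mono fun t ht => ⟨ht.1, hltT ht.2⟩)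
    (fun t ht => harc.follows t (EReal.coe_le_coe_iff.2 ht.1) (hltT ht.2.le)
      (EReal.coe_lt_coe_iff.2 ht.2))
    (fun t ht => hδ t ht.1 (hltT ht.2) (EReal.coe_le_coe_iff.2 ht.2)) (hD _ hmem) htrig

end Arc

theorem exists_le_lt_succ {α : Type*} [LinearOrder α] {τ : ℕ → α} {t : α} (h0 : τ 0 ≤ t)
    (hex : ∃ n, t < τ n) : ∃ n, τ n ≤ t ∧ t < τ (n + 1) := by
  by_contra! hall
  obtain ⟨n, hn⟩ := hex
  exact hn.not_ge (Nat.rec h0 (fun n ih => hall n ih) n)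

section TrajectoryBounds

variable {σ p δ rs c g t₀ : ℝ} {T : EReal}
  {y : ℝ → Vec k} {z : ℝ → Vec q} {τ : ℕ → EReal} {D : Set (Vec k × Vec q)}

theorem followsAt_iff {x : ℝ → Vec k × Vec q} {t : ℝ} {u : Vec m} :
    FollowsAt S (fun s => (x s).1) (fun s => (x s).2) t u ↔
      HasDerivWithinAt x (plantField S u (x t)) (Ici t) t :=
  (hasDerivWithinAt_prod (f := x) (f' := plantField S u (x t))).symm

theorem IsTrajectory.isArc (htr : IsTrajectory S K E h ha σ p D t₀ T y z τ) (n : ℕ) :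
    IsArc S (heldInput K n (y (τ n).toReal, z (τ n).toReal))
      (triggerSet E ha σ p n (y (τ n).toReal, z (τ n).toReal) ∩ coords E h ⁻¹' D) T (τ n)
      (τ (n + 1)) (fun t => (y t, z t)) := by
  rcases n with - | n
  · refine ⟨htr.first_event.congr fun t _ => ?_, fun t ht htT htτ => followsAt_iff.1 ?_⟩
    · simp [htr.start, triggerSet]
    · exact htr.zero_input t (EReal.coe_le_coe_iff.1 (htr.start ▸ ht)) htT htτ
  · exact ⟨htr.next_event _ n.succ_pos, fun t ht htT htτ =>
      followsAt_iff.1 (htr.held_input _ n.succ_pos t ht htT htτ)⟩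

theorem isTrajectory_of_isArc {x : ℝ → Vec k × Vec q}
    (hx : ContinuousOn x {t | t₀ ≤ t ∧ (t : EReal) < T}) (hτ : τ 0 = t₀)
    (hex : ∀ t : ℝ, ∃ i, (t : EReal) < τ i)
    (harc : ∀ n, IsArc S (heldInput K n (x (τ n).toReal))
      (triggerSet E ha σ p n (x (τ n).toReal) ∩ coords E h ⁻¹' D) T (τ n) (τ (n + 1)) x) :
    IsTrajectory S K E h ha σ p D t₀ T (fun t => (x t).1) (fun t => (x t).2) τ where
  y_cont := hx.fst
  z_cont := hx.snd
  start := hτ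
  first_event := (harc 0).first_time.congr fun t _ => by simp [hτ, triggerSet]
  next_event i hi := by
    obtain ⟨n, rfl⟩ := Nat.exists_eq_add_of_le' hi
    exact (harc (n + 1)).first_time
  zero_input t ht htT htτ := followsAt_iff.2
    ((harc 0).follows t (hτ ▸ EReal.coe_le_coe_iff.2 ht) htT htτ)
  held_input i hi t ht htT htτ := by
    obtain ⟨n, rfl⟩ := Nat.exists_eq_add_of_le' hi
    exact followsAt_iff.2 ((harc (n + 1)).follows t ht htT htτ)
  exhausts t _ _ := hex t

theorem IsTrajectory.continuousOn (htr : IsTrajectory S K E h ha σ p D t₀ T y z τ) :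
    ContinuousOn (fun t => (y t, z t)) {t | t₀ ≤ t ∧ (t : EReal) < T} :=
  htr.y_cont.prodMk htr.z_cont

theorem IsTrajectory.isDrivenAt (htr : IsTrajectory S K E h ha σ p D t₀ T y z τ) {t : ℝ}
    (ht₀ : t₀ ≤ t) (htT : (t : EReal) < T) :
    IsDrivenAt S K E h ha σ p D (fun t => (y t, z t)) t := by
  obtain ⟨n, hn, hlt⟩ :=
    exists_le_lt_succ (htr.start ▸ EReal.coe_le_coe_iff.2 ht₀) (htr.exhausts t ht₀ htT)
  exact ⟨_, (htr.isArc n).follows t hn htT hlt, fun hD => exists_law_eq_heldInput fun htrig =>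
    hlt.not_ge ((htr.isArc n).first_time.le ⟨hn, htT, htrig, hD⟩)⟩

variable (htr : IsTrajectory S K E h ha σ p (Sv k P δ \ S2 k P rs) t₀ T y z τ)
  (hdecay : DecaysAtRate S K E h ha P σ p δ rs c) (h₀ : toYW E h (y t₀) (z t₀) ∈ Sv k P δ)
include htr hdecay h₀

theorem IsTrajectory.mem_Sv_and_stateLyap_le {t : ℝ} (ht₀ : t₀ ≤ t) (htT : (t : EReal) < T) :
    toYW E h (y t) (z t) ∈ Sv k P δ ∧
      stateLyap E h P (y t, z t) ≤ max (slope₁ P * δ - c * (t - t₀)) (slope₁ P * rs) := by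
  have hltT {s : ℝ} (hs : s ≤ t) : (s : EReal) < T := (EReal.coe_le_coe_iff.2 hs).trans_lt htT
  exact hdecay _ _ _ (htr.continuousOn.mono fun s hs => ⟨hs.1, hltT hs.2⟩) h₀
    (fun s hs _ => htr.isDrivenAt hs.1 (hltT hs.2.le)) t ⟨ht₀, le_rfl⟩

theorem IsTrajectory.mem_ballYW (hq : 0 < q) (hP : P.PosDef) (hδ : 0 ≤ δ) (hrs : 0 ≤ rs)
    (hc : 0 < c) {t : ℝ} (ht : t₀ + slope₁ P * δ / c ≤ t) (htT : (t : EReal) < T) :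
    toYW E h (y t) (z t) ∈ ballYW k q rs := by
  have hα := slope₁_pos hq hP
  have hTb : slope₁ P * δ / c ≤ t - t₀ := by linarith
  have hlyap := (htr.mem_Sv_and_stateLyap_le hdecay h₀
    (sub_nonneg.1 (le_trans (by positivity) hTb)) htT).2
  have hspent : slope₁ P * δ - c * (t - t₀) ≤ slope₁ P * rs :=
    (sub_nonpos.2 ((div_le_iff₀' hc).1 hTb)).trans (by positivity)
  exact le_of_mul_le_mul_left
    (((slope₁_mul_le_lyap hP _ _).trans hlyap).trans (max_le hspent le_rfl)) hα

theorem IsTrajectory.event_add_le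
    (hgap : HasEventGap S K E h ha σ p δ (slope₁ P * rs / slope₂ P) g) {i : ℕ} (hi : 1 ≤ i) :
    τ i + (g : EReal) ≤ τ (i + 1) := by
  obtain ⟨n, rfl⟩ := Nat.exists_eq_add_of_le' hi
  have hmono : Monotone τ := monotone_nat_of_le_succ fun n => (htr.isArc n).le
  have hstart : (t₀ : EReal) ≤ τ (n + 1) := htr.start ▸ hmono (n + 1).zero_le
  have harc := htr.isArc (n + 1)
  rcases (htr.isArc n).first_time.eq_top_or_exists_mem with htop | ⟨a, -, haτ⟩
  · exact le_top.trans (htop ▸ harc.le)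
  rw [haτ, EReal.toReal_coe] at harc
  rw [haτ] at hstart ⊢
  have hat {t : ℝ} (ht : a ≤ t) : t₀ ≤ t := (EReal.coe_le_coe_iff.1 hstart).trans ht
  exact harc.add_le (x := fun t => (y t, z t)) hgap (fun ξ hξ => not_lt.1 hξ.2)
    (htr.continuousOn.mono fun t ht => ⟨hat ht.1, ht.2⟩)
    fun t ht htT _ => (htr.mem_Sv_and_stateLyap_le hdecay h₀ (hat ht) htT).1.1.le

end TrajectoryBounds

/-- The continuous curve `α` is at `x₀` at the time `a` and at `x₁` at the time `b`, as far as these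
times are finite. -/
structure IsPath {X : Type*} [TopologicalSpace X] (a : EReal) (x₀ : X) (b : EReal) (x₁ : X)
    (α : ℝ → X) : Prop where
  continuous : Continuous α
  start : ∀ r : ℝ, a = r → α r = x₀
  finish : ∀ r : ℝ, b = r → α r = x₁

section Concatenation

variable {X : Type*} [TopologicalSpace X] {τ : ℕ → EReal} {ξ : ℕ → X} {α : ℕ → ℝ → X}

theorem IsPath.eq_of_le (hα : ∀ n, IsPath (τ n) (ξ n) (τ (n + 1)) (ξ (n + 1)) (α n))
    (hτ : Monotone τ) {n N : ℕ} (hnN : n ≤ N) {t : ℝ} (htN : τ N ≤ t) (htn : t ≤ τ (n + 1)) :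
    α n t = α N t := by
  induction N, hnN using Nat.le_induction with
  | base => rfl
  | succ N hnN ih =>
    have ht : τ (N + 1) = t := htN.antisymm (htn.trans (hτ (Nat.succ_le_succ hnN)))
    rw [ih ((hτ N.le_succ).trans htN), (hα N).finish t ht, (hα (N + 1)).start t ht]

theorem exists_concatenation {t₀ : ℝ}
    (hα : ∀ n, IsPath (τ n) (ξ n) (τ (n + 1)) (ξ (n + 1)) (α n)) (hτ : Monotone τ)
    (h0 : τ 0 = t₀) (hex : ∀ t : ℝ, ∃ n, (t : EReal) < τ n) :
    ∃ x : ℝ → X, ContinuousOn x (Ici t₀) ∧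
      ∀ (n : ℕ) (t : ℝ), τ n ≤ t → t ≤ τ (n + 1) → x t = α n t := by
  have hindex (t : ℝ) : ∃ n, t₀ ≤ t → τ n ≤ t ∧ t < τ (n + 1) := by
    rcases le_or_gt t₀ t with ht | ht
    · exact (exists_le_lt_succ (h0 ▸ EReal.coe_le_coe_iff.2 ht) (hex t)).imp fun _ hn _ => hn
    · exact ⟨0, fun hle => absurd hle ht.not_ge⟩
  choose N hN using hindex
  have hx (n : ℕ) (t : ℝ) (hn : τ n ≤ t) (hn' : t ≤ τ (n + 1)) : α (N t) t = α n t := by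
    obtain ⟨hNt, htN⟩ := hN t (EReal.coe_le_coe_iff.1 (h0 ▸ (hτ n.zero_le).trans hn))
    exact (IsPath.eq_of_le hα hτ (Nat.lt_succ_iff.1 (hτ.reflect_lt (hn.trans_lt htN))) hNt hn').symm
  refine ⟨fun t => α (N t) t, ?_, hx⟩
  have hcover : Ici t₀ ⊆ ⋃ n, {t : ℝ | τ n ≤ t ∧ t ≤ τ (n + 1)} := fun t ht =>
    mem_iUnion.2 ⟨N t, (hN t ht).imp_right le_of_lt⟩
  refine ContinuousOn.mono (LocallyFinite.continuousOn_iUnion (fun t => ?_) (fun n => ?_)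
    fun n => ?_) hcover
  · obtain ⟨M, hM⟩ := hex t
    refine ⟨_, continuous_coe_real_ereal.continuousAt.eventually_lt_const hM,
      (finite_Iio M).subset ?_⟩
    rintro n ⟨s, hs, hsM⟩
    exact hτ.reflect_lt (hs.1.trans_lt hsM)
  · exact (isClosed_le continuous_const continuous_coe_real_ereal).inter
      (isClosed_le continuous_coe_real_ereal continuous_const)
  · exact (hα n).continuous.continuousOn.congr fun t ht => hx n t ht.1 ht.2

theorem exists_lt_of_add_le {t₀ g : ℝ} (hg : 0 < g) (h₀ : (t₀ : EReal) ≤ τ 0)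
    (hgap : ∀ n, τ n + (g : EReal) ≤ τ (n + 1)) (t : ℝ) : ∃ n, (t : EReal) < τ n := by
  have hlin (n : ℕ) : ((t₀ + n * g : ℝ) : EReal) ≤ τ n := by
    induction n with
    | zero => simpa using h₀
    | succ n ih =>
      have hsucc : (t₀ + (n + 1 : ℕ) * g : ℝ) = (t₀ + n * g) + g := by push_cast; ring
      rw [hsucc, EReal.coe_add]
      exact (add_le_add_left ih _).trans (hgap n)
  obtain ⟨n, hn⟩ := exists_nat_gt ((t - t₀) / g)
  refine ⟨n, (EReal.coe_lt_coe_iff.2 ?_).trans_le (hlin n)⟩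
  linarith [(div_lt_iff₀ hg).1 hn]

end Concatenation

section Construction

variable {ρ σ p δ rs c g t₀ : ℝ}

theorem exists_isTrajectory_of_isPath {D : Set (Vec k × Vec q)} {τ : ℕ → EReal}
    {ξ : ℕ → Vec k × Vec q} {α : ℕ → ℝ → Vec k × Vec q} (h0 : τ 0 = t₀)
    (hα : ∀ n, IsPath (τ n) (ξ n) (τ (n + 1)) (ξ (n + 1)) (α n))
    (harc : ∀ n, IsArc S (heldInput K n (ξ n))
      (triggerSet E ha σ p n (ξ n) ∩ coords E h ⁻¹' D) ⊤ (τ n) (τ (n + 1)) (α n))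
    (hex : ∀ t : ℝ, ∃ n, (t : EReal) < τ n) :
    ∃ x : ℝ → Vec k × Vec q, x t₀ = ξ 0 ∧
      IsTrajectory S K E h ha σ p D t₀ ⊤ (fun t => (x t).1) (fun t => (x t).2) τ := by
  have hτ : Monotone τ := monotone_nat_of_le_succ fun n => (harc n).le
  obtain ⟨x, hxc, hx⟩ := exists_concatenation hα hτ h0 hex
  have hxξ (n : ℕ) (r : ℝ) (hr : τ n = r) : x r = ξ n :=
    (hx n r hr.le (hr.ge.trans (hτ n.le_succ))).trans ((hα n).start r hr)
  refine ⟨x, hxξ 0 t₀ h0, isTrajectory_of_isArc (hxc.mono fun t ht => ht.1) h0 hex fun n => ?_⟩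
  by_cases hn : τ n = ⊤
  · rw [hn, show τ (n + 1) = ⊤ from top_le_iff.1 (hn ▸ (harc n).le)]
    exact isArc_top
  · have hbot : τ n ≠ ⊥ := ne_bot_of_le_ne_bot (EReal.coe_ne_bot t₀) (h0 ▸ hτ n.zero_le)
    rw [hxξ n _ (EReal.coe_toReal hn hbot).symm]
    exact (harc n).congr (hx n)

variable (hh : IsCenterManifold S K E h ρ) (hδ : δ < ρ)
  (hr : slope₁ P * rs / slope₂ P ≤ ρ) (hp : 0 ≤ p) (hha : Continuous ha)
  (hdecay : DecaysAtRate S K E h ha P σ p δ rs c)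
include hh hδ hr hp hha hdecay

theorem exists_isArc (n : ℕ) (a : ℝ) {x₀ : Vec k × Vec q} (h₀ : coords E h x₀ ∈ Sv k P δ) :
    ∃ (x : ℝ → Vec k × Vec q) (b : EReal), x a = x₀ ∧ Continuous x ∧
      IsArc S (heldInput K n x₀) (triggerSet E ha σ p n x₀ ∩
        coords E h ⁻¹' (Sv k P δ \ S2 k P rs)) ⊤ a b x ∧
      ∀ t : ℝ, a ≤ t → t ≤ b → coords E h (x t) ∈ Sv k P δ := by
  obtain ⟨x, hxa, hx, hfol⟩ := exists_solution_on_compact (f := plantField S (heldInput K n x₀))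
    (by fun_prop) (hh.isCompact_stateNorm_le hδ) a x₀
  set A := {x | stateNorm E h x ≤ δ ∧ slope₁ P * rs / slope₂ P ≤ stateNorm E h x}
  set G := triggerSet E ha σ p n x₀
  have hclosed : IsClosed {t | a ≤ t ∧ x t ∈ A ∩ G} := isClosed_Ici.inter
    (((hh.isCompact_annulus hδ hr).isClosed.inter (isClosed_triggerSet hha hp)).preimage hx)
  obtain ⟨b, hb⟩ := exists_isFirstTime hclosed ⟨a, fun t ht => ht.1⟩
  have hSv (t : ℝ) (hat : a ≤ t) (htb : t ≤ b) : coords E h (x t) ∈ Sv k P δ := by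
    refine (hdecay x a t hx.continuousOn (hxa ▸ h₀) (fun s hs hsδ =>
      ⟨_, (hfol s hsδ.le).hasDerivWithinAt, fun hD => exists_law_eq_heldInput fun hG => ?_⟩)
      t ⟨hat, le_rfl⟩).1
    have hbs := hb.le ⟨hs.1, ⟨hsδ.le, not_lt.1 hD.2⟩, hG⟩
    exact ((EReal.coe_lt_coe_iff.2 hs.2).trans_le htb).not_ge hbs
  refine ⟨x, b, hxa, hx, ⟨hb.congr fun t htb => ?_, fun t hat _ htb => ?_⟩, hSv⟩
  · rw [mem_ofPred_eq, mem_ofPred_eq, EReal.coe_le_coe_iff]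
    refine and_congr_right fun hat => ?_
    have hmem := hSv t hat htb
    exact ⟨fun ht => ⟨EReal.coe_lt_top t, ht.2, hmem, ht.1.2.not_gt⟩, fun ht =>
      ⟨⟨hmem.1.le, not_lt.1 ht.2.2.2⟩, ht.2.1⟩⟩
  · rw [EReal.coe_le_coe_iff] at hat
    exact (hfol t (hSv t hat htb.le).1.le).hasDerivWithinAt

theorem exists_isPath_isArc (hgap : HasEventGap S K E h ha σ p δ (slope₁ P * rs / slope₂ P) g)
    (n : ℕ) {a : EReal} (hbot : a ≠ ⊥) {x₀ : Vec k × Vec q} (h₀ : coords E h x₀ ∈ Sv k P δ) :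
    ∃ (b : EReal) (x₁ : Vec k × Vec q) (α : ℝ → Vec k × Vec q), b ≠ ⊥ ∧
      coords E h x₁ ∈ Sv k P δ ∧ IsPath a x₀ b x₁ α ∧
      IsArc S (heldInput K n x₀)
        (triggerSet E ha σ p n x₀ ∩ coords E h ⁻¹' (Sv k P δ \ S2 k P rs)) ⊤ a b α ∧
      (n ≠ 0 → a + (g : EReal) ≤ b) := by
  rcases eq_or_ne a ⊤ with rfl | htop
  · exact ⟨⊤, x₀, fun _ => x₀, top_ne_bot, h₀, ⟨continuous_const, fun _ _ => rfl, fun _ _ => rfl⟩,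
      isArc_top, fun _ => le_top⟩
  lift a to ℝ using ⟨htop, hbot⟩
  obtain ⟨α, b, rfl, hα, harc, hSv⟩ := exists_isArc hh hδ hr hp hha hdecay n a h₀
  have hstart (r : ℝ) (har : (a : EReal) = r) : α r = α a := by rw [EReal.coe_eq_coe_iff.1 har]
  have hab : n ≠ 0 → (a : EReal) + (g : EReal) ≤ b := fun hn => by
    obtain ⟨n, rfl⟩ := Nat.exists_eq_succ_of_ne_zero hn
    exact harc.add_le hgap (fun ξ hξ => not_lt.1 hξ.2) hα.continuousOn
      fun t hat _ htb => (hSv t hat htb).1.le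
  rcases harc.first_time.eq_top_or_exists_mem with rfl | ⟨b, hb, rfl⟩
  · exact ⟨⊤, α a, α, top_ne_bot, h₀,
      ⟨hα, hstart, fun r hr => absurd hr.symm (EReal.coe_ne_top r)⟩, harc, hab⟩
  · exact ⟨b, α b, α, EReal.coe_ne_bot b, hb.2.2.2.1,
      ⟨hα, hstart, fun r hbr => by rw [EReal.coe_eq_coe_iff.1 hbr]⟩, harc, hab⟩

theorem exists_isTrajectory (hg : 0 < g)
    (hgap : HasEventGap S K E h ha σ p δ (slope₁ P * rs / slope₂ P) g) (t₀ : ℝ)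
    {x₀ : Vec k × Vec q} (h₀ : coords E h x₀ ∈ Sv k P δ) :
    ∃ (x : ℝ → Vec k × Vec q) (τ : ℕ → EReal), x t₀ = x₀ ∧
      IsTrajectory S K E h ha σ p (Sv k P δ \ S2 k P rs) t₀ ⊤ (fun t => (x t).1)
        (fun t => (x t).2) τ := by
  let Event := {s : EReal × (Vec k × Vec q) // s.1 ≠ ⊥ ∧ coords E h s.2 ∈ Sv k P δ}
  have hstep (n : ℕ) (s : Event) : ∃ (s' : Event) (α : ℝ → Vec k × Vec q),
      IsPath s.1.1 s.1.2 s'.1.1 s'.1.2 α ∧ IsArc S (heldInput K n s.1.2)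
        (triggerSet E ha σ p n s.1.2 ∩ coords E h ⁻¹' (Sv k P δ \ S2 k P rs)) ⊤ s.1.1 s'.1.1 α ∧
      (n ≠ 0 → s.1.1 + (g : EReal) ≤ s'.1.1) := by
    obtain ⟨b, x₁, α, hb, hx₁, hα⟩ :=
      exists_isPath_isArc hh hδ hr hp hha hdecay hgap n s.2.1 s.2.2
    exact ⟨⟨(b, x₁), hb, hx₁⟩, α, hα⟩
  choose next α hpath harc hnext using hstep
  let s : ℕ → Event := fun n => n.rec ⟨(t₀, x₀), EReal.coe_ne_bot t₀, h₀⟩ next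
  have hex (t : ℝ) : ∃ n, (t : EReal) < (s n).1.1 := by
    obtain ⟨n, hn⟩ := exists_lt_of_add_le (τ := fun n => (s (n + 1)).1.1) hg (harc 0 (s 0)).le
      (fun n => hnext (n + 1) (s (n + 1)) n.succ_ne_zero) t
    exact ⟨n + 1, hn⟩
  obtain ⟨x, hx₀, htr⟩ := exists_isTrajectory_of_isPath (τ := fun n => (s n).1.1)
    (ξ := fun n => (s n).1.2) rfl (fun n => hpath n (s n)) (fun n => harc n (s n)) hex
  exact ⟨x, _, hx₀, htr⟩

end Construction

theorem continuous_polyMap (H : Fin q → MvPolynomial (Fin k) ℝ) : Continuous (polyMap H) :=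
  (PiLp.continuous_toLp 2 _).comp <| continuous_pi fun j =>
    (MvPolynomial.continuous_eval (H j)).comp (by fun_prop)

theorem lt_of_ballYW_subset_Sv (hk : 0 < k) {δ r : ℝ}
    (hr : 0 ≤ r) (hsub : ballYW k q r ⊆ Sv k P δ) : r < δ := by
  have hnorm : pairNorm (EuclideanSpace.single (⟨0, hk⟩ : Fin k) r) (0 : Vec q) = r := by
    simp [pairNorm, Real.sqrt_sq_eq_abs, abs_of_nonneg hr]
  have hmem : (EuclideanSpace.single (⟨0, hk⟩ : Fin k) r, (0 : Vec q)) ∈ Sv k P δ := hsub hnorm.le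
  exact hnorm ▸ hmem.1

theorem slope₁_mul_div_slope₂_le (P : Matrix (Fin q) (Fin q) ℝ) {r : ℝ} (hr : 0 ≤ r) :
    slope₁ P * r / slope₂ P ≤ r := by
  have hone : 1 ≤ slope₂ P :=
    one_le_mul_of_one_le_of_one_le (Real.one_le_sqrt.2 one_le_two) (le_max_left _ _)
  exact (div_le_iff₀' (one_pos.trans_le hone)).2
    (mul_le_mul_of_nonneg_right ((min_le_left _ _).trans hone) hr)

theorem DecreasesOn.mono {σ p cy cw δ δ' : ℝ}
    (hdec : DecreasesOn S K E h ha P σ p cy cw δ) (hδ : δ' ≤ δ) :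
    DecreasesOn S K E h ha P σ p cy cw δ' :=
  fun y w ey ev hyw => hdec y w ey ev (hyw.trans_le hδ)

end EventCenter

open EventCenter in
theorem proposition7_general {k q m : ℕ} (hk : 0 < k) (hq : 0 < q)
    (S : Plant k q m) (K : Feedback k q m)
    (hKn : ∀ η : Vec k, act S.B₂ (fderiv ℝ K.Kn 0 η) = 0)
    (E : Matrix (Fin q) (Fin k) ℝ) (hE : AK S K * E - E * S.A₁ + S.B₂ * K.K₁₂ = 0)
    (h : Vec k → Vec q) (ρ : ℝ) (hh : IsCenterManifold S K E h ρ) (hA₁ : S.A₁ = 0)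
    (p : ℝ) (hp : 0 < p) (k₆ : ℝ) (hk₆ : 0 < k₆)
    (hg_inner : ∀ᶠ y in 𝓝 (0 : Vec k), inner ℝ y (reducedG₁ S K E h y) ≤ -k₆ * ‖y‖ ^ (p + 1))
    (ha : Vec k → Vec q) (hha : Continuous ha) (s : ℝ) (hs : p < s)
    (hhha : (fun y => h y - ha y) =O[𝓝 0] fun y => ‖y‖ ^ s)
    (P Q : Matrix (Fin q) (Fin q) ℝ) (hP : P.PosDef) (hQ : Q.PosDef)
    (hLyap : (AK S K).transpose * P + P * AK S K = -Q)
    (sf : ℝ) (hsf : 0 < sf) (σ : ℝ) (hσ : 0 < σ)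
    (hσ_le : σ * (2 * opNorm (P * S.B₂ * K1 K E) * √(lambdaMax P))
      ≤ (1 - sf) * lambdaMin Q * √(lambdaMin P)) :
    ∃ δ₀ > 0, ∃ cy > 0, ∃ cw > 0, ∀ δ : ℝ, 0 < δ → δ ≤ δ₀ →
      DecreasesOn S K E h ha P σ p cy cw δ ∧
      ∀ rs : ℝ, 0 < rs → ballYW k q rs ⊆ Sv k P δ →
        (∀ (t₀ : ℝ) (y₀ : Vec k) (z₀ : Vec q), toYW E h y₀ z₀ ∈ Sv k P δ →
          ∃ (y : ℝ → Vec k) (z : ℝ → Vec q) (τ : ℕ → EReal), y t₀ = y₀ ∧ z t₀ = z₀ ∧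
            IsTrajectory S K E h ha σ p (Sv k P δ \ S2 k P rs) t₀ ⊤ y z τ) ∧
        ∃ Tb : ℝ, 0 ≤ Tb ∧ ∃ τmin : ℝ, 0 < τmin ∧
          ∀ (t₀ : ℝ) (T : EReal) (y : ℝ → Vec k) (z : ℝ → Vec q) (τ : ℕ → EReal),
            IsTrajectory S K E h ha σ p (Sv k P δ \ S2 k P rs) t₀ T y z τ →
            toYW E h (y t₀) (z t₀) ∈ Sv k P δ →
            (∀ t : ℝ, t₀ ≤ t → (t : EReal) < T → toYW E h (y t) (z t) ∈ Sv k P δ) ∧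
            (∀ t : ℝ, t₀ + Tb ≤ t → (t : EReal) < T → toYW E h (y t) (z t) ∈ ballYW k q rs) ∧
            (∀ i : ℕ, 1 ≤ i → τ i + (τmin : EReal) ≤ τ (i + 1)) := by
  have h0 : h 0 = ha 0 := sub_eq_zero.1 <| (hhha.eq_zero_imp).self_of_nhds <| by
    simp [(hp.trans hs).ne']
  obtain ⟨δ₁, hδ₁, cy, hcy, cw, hcw, hdec₁⟩ := hh.exists_decreasesOn hA₁ hKn hE hp hk₆ hg_inner
    hs hhha hq hP hQ hLyap hσ.le (gain_lt_of_le (lambdaMin_pos hq hQ)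
    (Real.sqrt_pos.2 (lambdaMax_pos hq hP)) (Real.sqrt_pos.2 (lambdaMin_pos hq hP)) hsf hσ_le)
  have hρ := hh.radius_pos
  refine ⟨min δ₁ (ρ / 2), by positivity, cy, hcy, cw, hcw, fun δ hδ hδle => ?_⟩
  have hdec := hdec₁.mono (hδle.trans (min_le_left _ _))
  refine ⟨hdec, fun rs hrs hsub => ?_⟩
  have hδρ : δ < ρ := (hδle.trans (min_le_right _ _)).trans_lt (half_lt_self hρ)
  have hrsδ : rs < δ := lt_of_ballYW_subset_Sv hk hrs.le hsub
  have hr : 0 < slope₁ P * rs / slope₂ P := div_pos (mul_pos (slope₁_pos hq hP) hrs) slope₂_pos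
  have hrρ := (slope₁_mul_div_slope₂_le P hrs.le).trans (hrsδ.trans hδρ).le
  obtain ⟨c, hc, hrate⟩ := exists_rate_lt (k := k) (q := q) hp.le hcy hcw hr
  have hdecay := hdec.decaysAtRate hq hh hP hδρ hrsδ hc fun ξ hξ => hrate ξ.1 ξ.2 (not_lt.1 hξ)
  obtain ⟨g, hg, hgap⟩ := hh.exists_hasEventGap hδρ hr hrρ hσ hp.le hha h0
  refine ⟨fun t₀ y₀ z₀ h₀ => ?_, slope₁ P * δ / c,
    div_nonneg (mul_nonneg (slope₁_pos hq hP).le hδ.le) hc.le, g, hg, fun t₀ T y z τ htr h₀ =>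
    ⟨fun t ht htT => (htr.mem_Sv_and_stateLyap_le hdecay h₀ ht htT).1,
      fun t => htr.mem_ballYW hdecay h₀ hq hP hδ.le hrs.le hc,
      fun i => htr.event_add_le hdecay h₀ hgap⟩⟩
  obtain ⟨x, τ, hx₀, htr⟩ := exists_isTrajectory hh hδρ hrρ hp.le hha hdecay hg hgap t₀
    (x₀ := (y₀, z₀)) h₀
  exact ⟨_, _, τ, congrArg Prod.fst hx₀, congrArg Prod.snd hx₀, htr⟩

theorem proposition7 {k q m : ℕ} (hk : 0 < k) (hq : 0 < q)
    (S : EventCenter.Plant k q m) (K : EventCenter.Feedback k q m)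
    (hKn : ∀ η : EventCenter.Vec k, EventCenter.act S.B₂ (fderiv ℝ K.Kn 0 η) = 0)
    (hHurwitz : ∀ μ ∈ spectrum ℂ ((EventCenter.AK S K).map (fun a : ℝ => (a : ℂ))), μ.re < 0)
    (E : Matrix (Fin q) (Fin k) ℝ)
    (hE : EventCenter.AK S K * E - E * S.A₁ + S.B₂ * K.K₁₂ = 0)
    (h : EventCenter.Vec k → EventCenter.Vec q) (ρ : ℝ)
    (hh : EventCenter.IsCenterManifold S K E h ρ)
    (hA₁ : S.A₁ = 0)
    (p : ℝ) (hp : 1 < p) (k₅ k₆ : ℝ) (hk₅ : 0 < k₅) (hk₆ : 0 < k₆)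
    (hg_le : ∀ᶠ y in 𝓝 (0 : EventCenter.Vec k),
      ‖EventCenter.reducedG₁ S K E h y‖ ≤ k₅ * ‖y‖ ^ p)
    (hg_inner : ∀ᶠ y in 𝓝 (0 : EventCenter.Vec k),
      inner ℝ y (EventCenter.reducedG₁ S K E h y) ≤ -k₆ * ‖y‖ ^ (p + 1))
    (H : Fin q → MvPolynomial (Fin k) ℝ) (s : ℝ) (hs : p < s)
    (hH : (fun y => h y - EventCenter.polyMap H y) =O[𝓝 0] fun y => ‖y‖ ^ s)
    (P Q : Matrix (Fin q) (Fin q) ℝ) (hP : P.PosDef) (hQ : Q.PosDef)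
    (hLyap : (EventCenter.AK S K).transpose * P + P * EventCenter.AK S K = -Q)
    (sf : ℝ) (hsf : sf ∈ Ioo (0 : ℝ) 1) (σ : ℝ) (hσ : 0 < σ)
    (hσ_le : σ * (2 * EventCenter.opNorm (P * S.B₂ * EventCenter.K1 K E)
        * √(EventCenter.lambdaMax P))
      ≤ (1 - sf) * EventCenter.lambdaMin Q * √(EventCenter.lambdaMin P)) :
    ∃ δ₀ > 0, ∃ cy > 0, ∃ cw > 0, ∀ δ : ℝ, 0 < δ → δ ≤ δ₀ →
      EventCenter.DecreasesOn S K E h (EventCenter.polyMap H) P σ p cy cw δ ∧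
      ∀ rs : ℝ, 0 < rs → EventCenter.ballYW k q rs ⊆ EventCenter.Sv k P δ →
        (∀ (t₀ : ℝ) (y₀ : EventCenter.Vec k) (z₀ : EventCenter.Vec q),
          EventCenter.toYW E h y₀ z₀ ∈ EventCenter.Sv k P δ →
          ∃ (y : ℝ → EventCenter.Vec k) (z : ℝ → EventCenter.Vec q) (τ : ℕ → EReal),
            y t₀ = y₀ ∧ z t₀ = z₀ ∧
            EventCenter.IsTrajectory S K E h (EventCenter.polyMap H) σ p
              (EventCenter.Sv k P δ \ EventCenter.S2 k P rs) t₀ ⊤ y z τ) ∧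
        ∃ Tb : ℝ, 0 ≤ Tb ∧ ∃ τmin : ℝ, 0 < τmin ∧
          ∀ (t₀ : ℝ) (T : EReal) (y : ℝ → EventCenter.Vec k) (z : ℝ → EventCenter.Vec q)
            (τ : ℕ → EReal),
            EventCenter.IsTrajectory S K E h (EventCenter.polyMap H) σ p
              (EventCenter.Sv k P δ \ EventCenter.S2 k P rs) t₀ T y z τ →
            EventCenter.toYW E h (y t₀) (z t₀) ∈ EventCenter.Sv k P δ →
            (∀ t : ℝ, t₀ ≤ t → (t : EReal) < T →
              EventCenter.toYW E h (y t) (z t) ∈ EventCenter.Sv k P δ) ∧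
            (∀ t : ℝ, t₀ + Tb ≤ t → (t : EReal) < T →
              EventCenter.toYW E h (y t) (z t) ∈ EventCenter.ballYW k q rs) ∧
            (∀ i : ℕ, 1 ≤ i → τ i + (τmin : EReal) ≤ τ (i + 1)) :=
  proposition7_general hk hq S K hKn E hE h ρ hh hA₁ p (zero_lt_one.trans hp) k₆ hk₆ hg_inner
    (EventCenter.polyMap H) (EventCenter.continuous_polyMap H) s hs hH P Q hP hQ hLyap sf hsf.1 σ hσ
    hσ_le
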